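/- For a group $G$ with a finite generating set $S$, let $d_S$ be the word metric. Consider a finite connected graph of groups with vertex groups $G_v$ and edge groups $H_e$ (each $H_e$ comes with injective homomorphisms into the vertex groups at the two ends of $e$). If one can choose finite generating sets $A_v$ of the $G_v$ and $B_e$ of the $H_e$ such that all the inclusions $(H_e,d_{B_e})\hookrightarrow(G_v,d_{A_v})$ preserve distances, then every group isomorphic to the fundamental group of the graph of groups is called an isometric amalgam of the $G_v$ along the $H_e$. Theorem A. Let $\mathcal G$ be a class of finitely generated groups that is closed under isometric amalgamation along finitely generated free groups; that is, $\mathcal G$ contains every isometric amalgam of groups $G_v\in\mathcal G$ along finitely generated free groups $H_e$ (the trivial group counts as free). Then for every $G\in\mathcal G$ there are a group $\widehat G\in\mathcal G$ that has no proper subgroups of finite index and an injective homomorphism $G\to\widehat G$ that is a quasi-isometric embedding with respect to the word metrics of any finite generating sets of $G$ and $\widehat G$. -/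

import Mathlib

universe u

namespace IsometricAmalgam

section WordMetric

variable {G : Type u} [Group G]

/-- `S` is a finite generating set of the group `G`. -/
def IsFiniteGeneratingSet (S : Set G) : Prop :=
  S.Finite ∧ Subgroup.closure S = ⊤

/-- The word length of `g` with respect to `S`: the least length of a word in the letters
`S ∪ S⁻¹` that represents `g`. (Only used for generating sets `S`, where such words exist.) -/
noncomputable def wordLength (S : Set G) (g : G) : ℕ :=
  sInf {n : ℕ | ∃ l : List G, (∀ x ∈ l, x ∈ S ∨ x⁻¹ ∈ S) ∧ l.prod = g ∧ l.length = n}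

/-- The word metric `d_S(g, h)`. -/
noncomputable def wordDist (S : Set G) (g h : G) : ℕ :=
  wordLength S (g⁻¹ * h)

end WordMetric

/-- `f : G → H` is isometric for the word metrics of the generating sets `S` and `T`. -/
def IsWordIsometry {G H : Type u} [Group G] [Group H] (S : Set G) (T : Set H) (f : G →* H) :
    Prop :=
  ∀ x y : G, wordDist T (f x) (f y) = wordDist S x y

/-- `f : G → H` is a quasi-isometric embedding for the word metrics of the generating sets
`S` and `T`. -/
def IsQuasiIsometricEmbedding {G H : Type u} [Group G] [Group H] (S : Set G) (T : Set H)
    (f : G → H) : Prop :=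
  ∃ K C : ℝ, 1 ≤ K ∧ 0 ≤ C ∧ ∀ x y : G,
    (1 / K) * (wordDist S x y : ℝ) - C ≤ (wordDist T (f x) (f y) : ℝ) ∧
      (wordDist T (f x) (f y) : ℝ) ≤ K * (wordDist S x y : ℝ) + C

/-- A graph of groups. The underlying graph has vertex set `V`; the set `E` holds one chosen
orientation of each geometric edge, so that loops and multiple edges are allowed. Each edge
group is embedded in the vertex groups at both ends of the edge. -/
structure GraphOfGroups (V E : Type) where
  /-- initial vertex of an edge -/
  source : E → V
  /-- terminal vertex of an edge -/
  target : E → V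
  /-- vertex groups -/
  vertexGroup : V → Type u
  /-- edge groups -/
  edgeGroup : E → Type u
  [vertexGroupStr : ∀ v, Group (vertexGroup v)]
  [edgeGroupStr : ∀ e, Group (edgeGroup e)]
  /-- inclusion of an edge group at the initial vertex -/
  sourceMap : ∀ e, edgeGroup e →* vertexGroup (source e)
  /-- inclusion of an edge group at the terminal vertex -/
  targetMap : ∀ e, edgeGroup e →* vertexGroup (target e)
  sourceMap_injective : ∀ e, Function.Injective (sourceMap e)
  targetMap_injective : ∀ e, Function.Injective (targetMap e)

attribute [instance] GraphOfGroups.vertexGroupStr GraphOfGroups.edgeGroupStr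

namespace GraphOfGroups

variable {V E : Type} (X : GraphOfGroups.{u} V E)

/-- The unordered pair of end points of an edge. -/
def ends (e : E) : Sym2 V := s(X.source e, X.target e)

/-- `T` is (the edge set of) a spanning tree of the underlying graph: it contains no loop and no
two parallel edges, and the simple graph on all of `V` that it defines is a tree. Such a `T`
exists only if the underlying graph is non-empty and connected. -/
def IsSpanningTree (T : Set E) : Prop :=
  (∀ e ∈ T, X.source e ≠ X.target e) ∧ Set.InjOn X.ends T ∧
    (SimpleGraph.fromEdgeSet (X.ends '' T)).IsTree

/-- The free product of all vertex groups and of the free group on the stable letters. -/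
abbrev FreeProduct : Type u :=
  Monoid.Coprod (Monoid.CoprodI X.vertexGroup) (FreeGroup E)

/-- An element of a vertex group, in the free product. -/
def ofVertex (v : V) : X.vertexGroup v →* X.FreeProduct :=
  Monoid.Coprod.inl.comp Monoid.CoprodI.of

/-- The stable letter of an edge, in the free product. -/
def stable (e : E) : X.FreeProduct :=
  Monoid.Coprod.inr (FreeGroup.of e)

/-- The relators of the fundamental group: the stable letter of `e` conjugates one copy of the
edge group to the other, and the stable letters of the edges in `T` are trivial. -/
def relators (T : Set E) : Set X.FreeProduct :=
  {r | ∃ (e : E) (h : X.edgeGroup e),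
      r = (X.stable e)⁻¹ * X.ofVertex (X.source e) (X.sourceMap e h) * X.stable e *
        (X.ofVertex (X.target e) (X.targetMap e h))⁻¹} ∪
    {r | ∃ e ∈ T, r = X.stable e}

/-- The fundamental group of the graph of groups with respect to the spanning tree `T`. -/
abbrev FundamentalGroup (T : Set E) : Type u :=
  X.FreeProduct ⧸ Subgroup.normalClosure (X.relators T)

/-- One can choose finite generating sets for all vertex groups and all edge groups, one for
each of these groups, such that all inclusions of edge groups in vertex groups are isometric
for the corresponding word metrics. -/
def IsIsometric : Prop :=
  ∃ (A : ∀ v, Set (X.vertexGroup v)) (B : ∀ e, Set (X.edgeGroup e)),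
    (∀ v, IsFiniteGeneratingSet (A v)) ∧ (∀ e, IsFiniteGeneratingSet (B e)) ∧
      ∀ e, IsWordIsometry (B e) (A (X.source e)) (X.sourceMap e) ∧
        IsWordIsometry (B e) (A (X.target e)) (X.targetMap e)

end GraphOfGroups

/-- The class `𝒢` of groups is closed under isometric amalgamation along finitely generated free
groups: if `Γ` is (isomorphic to) the fundamental group of a finite isometric graph of groups
whose vertex groups belong to `𝒢` and whose edge groups are finitely generated free groups,
then `Γ` belongs to `𝒢`. -/
def ClosedUnderIsometricFreeAmalgamation (𝒢 : ∀ (G : Type u) [Group G], Prop) : Prop :=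
  ∀ (V E : Type) [Finite V] [Finite E] (X : GraphOfGroups.{u} V E) (T : Set E),
    X.IsSpanningTree T → X.IsIsometric →
    (∀ v, 𝒢 (X.vertexGroup v)) →
    (∀ e, Group.FG (X.edgeGroup e) ∧ IsFreeGroup (X.edgeGroup e)) →
    ∀ (Γ : Type u) [Group Γ], Nonempty (Γ ≃* X.FundamentalGroup T) → 𝒢 Γ

end IsometricAmalgam

/-!
Let `G` belong to the class, with a finite generating set `S`. The proof embeds `G` as a retract in
a group `P` of the class, obtained by adjoining stable letters one at a time, and takes for `Ghat`
an amalgam of two copies of `P` along a free group.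

**Undetectable elements.** Adjoin to `G` letters `a`, `b`, `s`, `x`, `t` with
`a * b = b * a`, `s * a * s⁻¹ = t * b * t⁻¹ = (a * b) ^ p` and `x * a = a * x`. In a finite
quotient `a`, `b` and `(a * b) ^ p` have the same order, so `a * b` has this order too, and is
therefore a power of `(a * b) ^ p`. It follows that `u = s⁻¹ * (a * b) * s`, a `p`-th root of `a`,
is a power of `a` in the quotient and commutes with `x` (`commute_of_finite`). Thus the elements
`d j = u ^ j * x * (u ^ j)⁻¹ * x⁻¹` are trivial in all finite quotients.

**The amalgam.** Let `γ k` run through `S`, `a`, `s`, `x`. For suitable exponents the elements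
`d k * γ k`, one further element `d` for each of these and for `t`, and `t` itself form an isometric
basis of a free subgroup. `Ghat` is the amalgam of two copies of `P` along this subgroup, where the
identification exchanges the elements `d k * γ k` and `t` of either copy with the further elements
`d` of the other. In a finite quotient of `Ghat` all `d` die, hence all `γ k` and `t` die, and then
`b`, so everything dies (`exists_factor`).

**Isometries.** In an HNN extension along isometric subgroups, removing a pinch from a word does
not increase its length, so by Britton's lemma the base group is isometric (`wordLength_of`).
To see that the free subgroup above is isometric, note that before `t` is adjoined there is a
homomorphism to the wreath product of a free group with a cyclic group of order `p`, which sends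
`u` and `b` to the generator of the cyclic group, and sends `x` to a tuple of basis elements placed
so that distinct `d k` have distinct basis elements as coordinate at `1`. The maximal norm of a
coordinate is a length function that detects the family; since it vanishes on the subgroups
generated by `b` and `(a * b) ^ p`, words in the family and in `t` are reduced words in the HNN
extension `P`, and their length can be read off (`isIsometricFamily_option`).

**Quasi-isometry.** `G` is a retract of `P`. The first copy of `P` in `Ghat` is quasi-isometrically
embedded because `Ghat` maps to the HNN extension of the free product of the two copies that
conjugates one free subgroup to the other, and there the copy is isometric
(`exists_wordLength_le_amalgam`).
-/

namespace IsometricAmalgam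

/-! ### Length functions and word lengths -/

section Length

variable {G H : Type*} [Group G] [Group H]

/-- A length function: a symmetric, subadditive function vanishing at `1`. It may vanish at other
elements as well. -/
structure IsLengthFunction (ℓ : G → ℕ) : Prop where
  map_one : ℓ 1 = 0
  map_mul_le : ∀ x y, ℓ (x * y) ≤ ℓ x + ℓ y
  map_inv : ∀ x, ℓ x⁻¹ = ℓ x

namespace IsLengthFunction

variable {ℓ : G → ℕ}

theorem comp {ℓ : H → ℕ} (h : IsLengthFunction ℓ) (f : G →* H) :
    IsLengthFunction fun x => ℓ (f x) :=
  ⟨by simpa using h.map_one, fun x y => by simpa using h.map_mul_le (f x) (f y),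
    fun x => by simpa using h.map_inv (f x)⟩

theorem mul_left_of_eq_zero (h : IsLengthFunction ℓ) {x : G} (hx : ℓ x = 0) (y : G) :
    ℓ (x * y) = ℓ y := by
  apply le_antisymm
  · simpa [hx] using h.map_mul_le x y
  · have := h.map_mul_le x⁻¹ (x * y)
    rwa [inv_mul_cancel_left, h.map_inv, hx, zero_add] at this

theorem mul_right_of_eq_zero (h : IsLengthFunction ℓ) {x : G} (hx : ℓ x = 0) (y : G) :
    ℓ (y * x) = ℓ y := by
  rw [← h.map_inv, mul_inv_rev, h.mul_left_of_eq_zero (by rw [h.map_inv, hx]), h.map_inv]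

theorem prod_le (h : IsLengthFunction ℓ) {S : Set G} {N : ℕ} (hS : ∀ x ∈ S, ℓ x ≤ N) :
    ∀ l : List G, (∀ x ∈ l, x ∈ S ∨ x⁻¹ ∈ S) → ℓ l.prod ≤ N * l.length
  | [], _ => by simp [h.map_one]
  | x :: l, hl => by
    have h1 : ℓ x ≤ N := by
      rcases hl x (by simp) with h1 | h1
      · exact hS x h1
      · exact h.map_inv x ▸ hS _ h1
    have h2 := h.prod_le hS l fun y hy => hl y (List.mem_cons_of_mem _ hy)
    rw [List.prod_cons, List.length_cons]
    calc ℓ (x * l.prod) ≤ ℓ x + ℓ l.prod := h.map_mul_le _ _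
      _ ≤ N * (l.length + 1) := by rw [mul_add]; omega

end IsLengthFunction

theorem isLengthFunction_norm {α : Type*} [DecidableEq α] :
    IsLengthFunction (FreeGroup.norm : FreeGroup α → ℕ) :=
  ⟨FreeGroup.norm_one, FreeGroup.norm_mul_le, fun _ => FreeGroup.norm_inv_eq⟩

end Length

section WordLength

variable {G H : Type u} [Group G] [Group H] {S : Set G} {T : Set H}

theorem wordLength_le {l : List G} (hl : ∀ x ∈ l, x ∈ S ∨ x⁻¹ ∈ S) :
    wordLength S l.prod ≤ l.length :=
  Nat.sInf_le ⟨l, hl, rfl, rfl⟩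

theorem exists_list_length_eq_wordLength (hS : Subgroup.closure S = ⊤) (g : G) :
    ∃ l : List G, (∀ x ∈ l, x ∈ S ∨ x⁻¹ ∈ S) ∧ l.prod = g ∧ l.length = wordLength S g := by
  have hg : g ∈ (Subgroup.closure S).toSubmonoid := by simp [hS]
  rw [Subgroup.closure_toSubmonoid] at hg
  obtain ⟨l, hl, hp⟩ := Submonoid.exists_list_of_mem_closure hg
  exact Nat.sInf_mem (s := {n | ∃ l : List G, (∀ x ∈ l, x ∈ S ∨ x⁻¹ ∈ S) ∧ l.prod = g ∧
    l.length = n}) ⟨l.length, l, hl, hp, rfl⟩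

theorem isLengthFunction_wordLength (hS : Subgroup.closure S = ⊤) :
    IsLengthFunction (wordLength S) where
  map_one := by simpa using wordLength_le (S := S) (l := []) (by simp)
  map_mul_le x y := by
    obtain ⟨l, hl, rfl, hl'⟩ := exists_list_length_eq_wordLength hS x
    obtain ⟨m, hm, rfl, hm'⟩ := exists_list_length_eq_wordLength hS y
    rw [← hl', ← hm', ← List.prod_append, ← List.length_append]
    exact wordLength_le fun z hz => (List.mem_append.1 hz).elim (hl z) (hm z)
  map_inv := by
    have key : ∀ x, wordLength S x⁻¹ ≤ wordLength S x := fun x => by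
      obtain ⟨l, hl, rfl, hl'⟩ := exists_list_length_eq_wordLength hS x
      rw [← hl', List.prod_inv_reverse]
      refine (wordLength_le fun z hz => ?_).trans (by simp)
      simp only [List.mem_reverse, List.mem_map] at hz
      obtain ⟨y, hy, rfl⟩ := hz
      simpa using (hl y hy).symm
    exact fun x => le_antisymm (key x) (by simpa using key x⁻¹)

theorem wordLength_le_one {g : G} (hg : g ∈ S) : wordLength S g ≤ 1 := by
  simpa using wordLength_le (S := S) (l := [g]) (by simp [hg])

theorem eq_one_of_wordLength_eq_zero (hS : Subgroup.closure S = ⊤) {g : G}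
    (hg : wordLength S g = 0) : g = 1 := by
  obtain ⟨l, -, rfl, hl⟩ := exists_list_length_eq_wordLength hS g
  rw [hg, List.length_eq_zero_iff] at hl
  simp [hl]

theorem IsLengthFunction.le_mul_wordLength {ℓ : G → ℕ} (h : IsLengthFunction ℓ)
    (hS : Subgroup.closure S = ⊤) {N : ℕ} (hN : ∀ x ∈ S, ℓ x ≤ N) (g : G) :
    ℓ g ≤ N * wordLength S g := by
  obtain ⟨l, hl, rfl, hl'⟩ := exists_list_length_eq_wordLength hS g
  rw [← hl']
  exact h.prod_le hN l hl

/-- Homomorphisms between finitely generated groups are Lipschitz. -/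
theorem exists_wordLength_map_le (hS : IsFiniteGeneratingSet S)
    (hT : Subgroup.closure T = ⊤) (f : G →* H) :
    ∃ C : ℕ, ∀ g, wordLength T (f g) ≤ C * wordLength S g := by
  obtain ⟨C, hC⟩ := (hS.1.image fun x => wordLength T (f x)).bddAbove
  exact ⟨C, ((isLengthFunction_wordLength hT).comp f).le_mul_wordLength hS.2
    fun x hx => hC ⟨x, hx, rfl⟩⟩

end WordLength

/-! ### Isometric families -/

section Family

variable {G H : Type u} [Group G] [Group H] {S : Set G} {ι : Type*}

open Classical in
/-- The family `f` freely generates a subgroup of `G`, and the word metric of this subgroup with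
respect to the basis `f` is the restriction of the word metric of `G` with respect to `S`. -/
def IsIsometricFamily (S : Set G) (f : ι → G) : Prop :=
  ∀ w : FreeGroup ι, wordLength S (FreeGroup.lift f w) = w.norm

theorem exists_list_norm [DecidableEq ι] (w : FreeGroup ι) :
    ∃ l : List (FreeGroup ι),
      (∀ x ∈ l, x ∈ Set.range FreeGroup.of ∨ x⁻¹ ∈ Set.range FreeGroup.of) ∧
        l.prod = w ∧ l.length = w.norm := by
  refine ⟨w.toWord.map fun x => cond x.2 (FreeGroup.of x.1) (FreeGroup.of x.1)⁻¹, ?_, ?_, ?_⟩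
  · intro x hx
    simp only [List.mem_map] at hx
    obtain ⟨⟨i, b⟩, -, rfl⟩ := hx
    cases b <;> simp
  · conv_rhs => rw [← FreeGroup.lift_of_apply (α := ι) w, ← FreeGroup.mk_toWord (x := w)]
    rw [FreeGroup.lift_mk]
  · simp [FreeGroup.norm]

theorem wordLength_lift_le [DecidableEq ι] {f : ι → G} (hf : ∀ i, f i ∈ S) (w : FreeGroup ι) :
    wordLength S (FreeGroup.lift f w) ≤ w.norm := by
  obtain ⟨l, hl, rfl, hl'⟩ := exists_list_norm w
  rw [← hl', map_list_prod, ← l.length_map (f := FreeGroup.lift f)]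
  refine wordLength_le fun x hx => ?_
  obtain ⟨y, hy, rfl⟩ := List.mem_map.1 hx
  rcases hl y hy with ⟨i, rfl⟩ | ⟨i, hi⟩
  · simp [hf]
  · right
    rw [← map_inv, ← hi]
    simp [hf]

/-- A length function that is at most `N` on the generating set `S`, and at least `N` times the
norm on the words in `f`, shows that a family of elements of `S` is isometric. -/
theorem isIsometricFamily_of_isLengthFunction [DecidableEq ι] (hS : Subgroup.closure S = ⊤)
    {f : ι → G} (hf : ∀ i, f i ∈ S) {ℓ : G → ℕ} (h : IsLengthFunction ℓ) {N : ℕ} (hN : 0 < N)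
    (hSN : ∀ x ∈ S, ℓ x ≤ N) (hw : ∀ w : FreeGroup ι, N * w.norm ≤ ℓ (FreeGroup.lift f w)) :
    IsIsometricFamily S f := by
  intro w
  convert le_antisymm (wordLength_lift_le hf w) ?_
  exact Nat.le_of_mul_le_mul_left ((hw w).trans (h.le_mul_wordLength hS hSN _)) hN

theorem IsIsometricFamily.injective (hS : Subgroup.closure S = ⊤) {f : ι → G}
    (h : IsIsometricFamily S f) : Function.Injective (FreeGroup.lift f) := by
  classical
  rw [injective_iff_map_eq_one]
  intro w hw
  have := h w
  rw [hw, (isLengthFunction_wordLength hS).map_one] at this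
  exact FreeGroup.norm_eq_zero.1 this.symm

theorem wordLength_range_of {ι : Type u} [DecidableEq ι] (w : FreeGroup ι) :
    wordLength (Set.range FreeGroup.of) w = w.norm := by
  have hS : Subgroup.closure (Set.range (FreeGroup.of : ι → _)) = ⊤ := FreeGroup.closure_range_of ι
  apply le_antisymm
  · simpa only [FreeGroup.lift_of_apply] using
      wordLength_lift_le (S := Set.range FreeGroup.of) (f := FreeGroup.of) (by simp) w
  · simpa using isLengthFunction_norm.le_mul_wordLength hS (N := 1) (by simp) w

theorem IsIsometricFamily.isWordIsometry {ι : Type u} {f : ι → G} (h : IsIsometricFamily S f) :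
    IsWordIsometry (Set.range FreeGroup.of) S (FreeGroup.lift f) := by
  classical
  intro x y
  rw [wordDist, wordDist, ← map_inv, ← map_mul, wordLength_range_of]
  convert h _

end Family

/-! ### Lengths in HNN extensions -/

section HNN

open HNNExtension HNNExtension.NormalWord

variable {G : Type*} [Group G] {A B : Subgroup G} {φ : A ≃* B} {ℓ : G → ℕ}

theorem t_zpow_mul_of (u : ℤˣ) (a : toSubgroup A B u) :
    (t ^ (u : ℤ) * of (a : G) : HNNExtension G A B φ) =
      of (toSubgroupEquiv φ u a : G) * t ^ (u : ℤ) := by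
  rcases Int.units_eq_one_or u with rfl | rfl
  · rw [Units.val_one, zpow_one]
    exact t_mul_of a
  · rw [Units.val_neg, Units.val_one, zpow_neg_one]
    exact inv_t_mul_of a

theorem length_toSubgroupEquiv (hφ : ∀ a : A, ℓ (φ a : G) = ℓ a) (u : ℤˣ)
    (a : toSubgroup A B u) : ℓ (toSubgroupEquiv φ u a : G) = ℓ a := by
  rcases Int.units_eq_one_or u with rfl | rfl
  · exact hφ a
  · exact (hφ (φ.symm a)).symm.trans (congrArg (fun b : B => ℓ b) (φ.apply_symm_apply a))

/-- The cost of a reduced word: each stable letter counts `1`, and each letter of the base group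
counts its length. -/
def cost (ℓ : G → ℕ) (w : ReducedWord G A B) : ℕ :=
  ℓ w.head + (w.toList.map fun x => 1 + ℓ x.2).sum

/-- Multiplying by a stable letter either extends the reduced word or removes a pinch. -/
theorem exists_reducedWord_t_mul (h : IsLengthFunction ℓ) (hφ : ∀ a : A, ℓ (φ a : G) = ℓ a)
    (u : ℤˣ) (w : ReducedWord G A B) :
    ∃ w' : ReducedWord G A B, w'.prod φ = t ^ (u : ℤ) * w.prod φ ∧ cost ℓ w' ≤ 1 + cost ℓ w := by
  obtain ⟨g, l, hl⟩ := w
  by_cases hc : ∀ y ∈ l.head?, g ∈ toSubgroup A B u → u = y.1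
  · refine ⟨⟨1, (u, g) :: l, List.isChain_cons.2 ⟨hc, hl⟩⟩, ?_, ?_⟩
    · simp [ReducedWord.prod, mul_assoc]
    · simp [cost, h.map_one, add_assoc]
  · push Not at hc
    obtain ⟨⟨v, k⟩, hv, hg, huv⟩ := hc
    obtain ⟨l, rfl⟩ := List.head?_eq_some_iff.1 hv
    obtain rfl : v = -u := by
      rcases Int.units_eq_one_or u with rfl | rfl <;>
        rcases Int.units_eq_one_or v with rfl | rfl <;> simp_all
    refine ⟨⟨toSubgroupEquiv φ u ⟨g, hg⟩ * k, l, (List.isChain_cons.1 hl).2⟩, ?_, ?_⟩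
    · have := t_zpow_mul_of (φ := φ) u ⟨g, hg⟩
      simp only [ReducedWord.prod, List.map_cons, List.prod_cons, ← mul_assoc] at this ⊢
      rw [this]
      simp
    · have h1 := h.map_mul_le (toSubgroupEquiv φ u ⟨g, hg⟩) k
      rw [length_toSubgroupEquiv hφ] at h1
      simp only [cost, List.map_cons, List.sum_cons] at h1 ⊢
      omega

/-- A product of `n` letters, each of which is a stable letter or an element of length at most `1`
of the base group, is represented by a reduced word of cost at most `n`: removing a pinch
`t ^ u * a * t ^ (-u)` does not increase the cost. -/
theorem exists_reducedWord_cost_le (h : IsLengthFunction ℓ) (hφ : ∀ a : A, ℓ (φ a : G) = ℓ a)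
    {S : Set G} (hS : ∀ x ∈ S, ℓ x ≤ 1) :
    ∀ l : List (HNNExtension G A B φ),
      (∀ x ∈ l, x ∈ of '' S ∪ {t} ∨ x⁻¹ ∈ (of '' S ∪ {t} : Set (HNNExtension G A B φ))) →
      ∃ w : ReducedWord G A B, w.prod φ = l.prod ∧ cost ℓ w ≤ l.length
  | [], _ => ⟨ReducedWord.empty G A B, by simp [ReducedWord.prod], by simp [cost, h.map_one]⟩
  | x :: l, hl => by
    obtain ⟨w, hw, hw'⟩ := exists_reducedWord_cost_le h hφ hS l
      fun y hy => hl y (List.mem_cons_of_mem _ hy)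
    have hG : ∀ g : G, ℓ g ≤ 1 → x = of g → ∃ w : ReducedWord G A B,
        w.prod φ = (x :: l).prod ∧ cost ℓ w ≤ (x :: l).length := by
      rintro g hg rfl
      refine ⟨⟨g * w.head, w.toList, w.chain⟩, ?_, ?_⟩
      · rw [List.prod_cons, ← hw]
        simp [ReducedWord.prod, mul_assoc]
      · have := h.map_mul_le g w.head
        simp only [cost, List.length_cons] at hw' ⊢
        omega
    have ht : ∀ u : ℤˣ, x = t ^ (u : ℤ) → ∃ w : ReducedWord G A B,
        w.prod φ = (x :: l).prod ∧ cost ℓ w ≤ (x :: l).length := by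
      rintro u rfl
      obtain ⟨w', h1, h2⟩ := exists_reducedWord_t_mul h hφ u w
      exact ⟨w', by rw [h1, hw, List.prod_cons], by rw [List.length_cons]; omega⟩
    rcases hl x (by simp) with (⟨g, hg, hx⟩ | hx) | (⟨g, hg, hx⟩ | hx)
    · exact hG g (hS g hg) hx.symm
    · exact ht 1 (by simpa using hx)
    · exact hG g⁻¹ (by rw [h.map_inv]; exact hS g hg) (by rw [map_inv, hx, inv_inv])
    · exact ht (-1) (by simpa [← inv_eq_iff_eq_inv] using hx)

theorem closure_image_of_union_t {S : Set G} (hS : Subgroup.closure S = ⊤) :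
    Subgroup.closure (of '' S ∪ {t} : Set (HNNExtension G A B φ)) = ⊤ := by
  rw [eq_top_iff]
  intro x _
  induction x using HNNExtension.induction_on with
  | of g =>
    have : g ∈ Subgroup.closure S := by simp [hS]
    refine Subgroup.closure_mono Set.subset_union_left ?_
    rw [← MonoidHom.map_closure]
    exact ⟨g, this, rfl⟩
  | t => exact Subgroup.subset_closure (Or.inr rfl)
  | mul x y hx hy => exact mul_mem (hx trivial) (hy trivial)
  | inv x hx => exact inv_mem (hx trivial)

/-- In an HNN extension along isometric subgroups, the base group is isometric. -/
theorem wordLength_of {G : Type u} [Group G] {A B : Subgroup G} {φ : A ≃* B} {S : Set G}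
    (hS : Subgroup.closure S = ⊤) (hφ : ∀ a : A, wordLength S (φ a : G) = wordLength S a) (g : G) :
    wordLength (of '' S ∪ {t}) (of g : HNNExtension G A B φ) = wordLength S g := by
  apply le_antisymm
  · obtain ⟨l, hl, rfl, hl'⟩ := exists_list_length_eq_wordLength hS g
    rw [← hl', map_list_prod, ← l.length_map (f := of (φ := φ))]
    refine wordLength_le fun x hx => ?_
    obtain ⟨y, hy, rfl⟩ := List.mem_map.1 hx
    exact (hl y hy).imp (fun h => Or.inl ⟨y, h, rfl⟩) (fun h => Or.inl ⟨_, h, map_inv _ _⟩)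
  · obtain ⟨l, hl, hp, hl'⟩ := exists_list_length_eq_wordLength
      (closure_image_of_union_t (φ := φ) hS) (of g)
    obtain ⟨⟨k, m, hm⟩, hw, hw'⟩ := exists_reducedWord_cost_le (isLengthFunction_wordLength hS) hφ
      (fun x hx => wordLength_le_one hx) l hl
    rw [hp] at hw
    obtain rfl : m = [] := ReducedWord.toList_eq_nil_of_mem_of_range φ _ ⟨g, hw.symm⟩
    obtain rfl : k = g := of_injective (φ := φ) (by simpa [ReducedWord.prod] using hw)
    rw [← hl']
    simpa [cost] using hw'

/-- If the length vanishes on the associated subgroups, all reduced words representing an element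
have the same cost. -/
theorem cost_eq_of_prod_eq (h : IsLengthFunction ℓ) (hA : ∀ a ∈ A, ℓ a = 0) (hB : ∀ b ∈ B, ℓ b = 0)
    (w w' : ReducedWord G A B) (hp : w.prod φ = w'.prod φ) : cost ℓ w = cost ℓ w' := by
  have h0 : ∀ u : ℤˣ, ∀ a ∈ toSubgroup A B u, ℓ a = 0 := fun u a ha => by
    rcases Int.units_eq_one_or u with rfl | rfl
    exacts [hA a ha, hB a ha]
  obtain ⟨g, l, hl⟩ := w
  obtain ⟨g', l', hl'⟩ := w'
  induction l generalizing g g' l' with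
  | nil =>
    obtain rfl : l' = [] := by
      simpa using (ReducedWord.map_fst_eq_and_of_prod_eq φ hp).1
    obtain rfl : g = g' := of_injective (φ := φ) (by simpa [ReducedWord.prod] using hp)
    rfl
  | cons x l ih =>
    obtain ⟨u, k⟩ := x
    obtain ⟨h1, h2⟩ := ReducedWord.map_fst_eq_and_of_prod_eq φ hp
    rcases l' with _ | ⟨⟨v, k'⟩, l'⟩
    · simp at h1
    obtain ⟨rfl, -⟩ : u = v ∧ _ := by simpa using h1
    specialize h2 u (by simp)
    dsimp only at h2
    -- moving `g⁻¹ * g'` through the first stable letter changes the head of the tail only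
    have h3 : (⟨k, l, (List.isChain_cons.1 hl).2⟩ : ReducedWord G A B).prod φ =
        (⟨toSubgroupEquiv φ (-u) ⟨_, h2⟩ * k', l', (List.isChain_cons.1 hl').2⟩ :
          ReducedWord G A B).prod φ := by
      have h4 := t_zpow_mul_of (φ := φ) (-u) ⟨_, h2⟩
      simp only [ReducedWord.prod, List.map_cons, List.prod_cons, map_mul, map_inv, Units.val_neg,
        zpow_neg, mul_assoc] at hp h4 ⊢
      have h5 := eq_mul_inv_of_mul_eq h4.symm
      rw [h5, inv_inv]
      simp only [mul_assoc]
      rw [← hp]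
      group
    have h5 := ih _ _ _ _ _ h3
    have h6 := h.mul_left_of_eq_zero (h0 _ _ h2) g
    have h7 := h.mul_left_of_eq_zero (h0 _ _ (toSubgroupEquiv φ (-u) ⟨_, h2⟩).2) k'
    have h8 : ℓ g' = ℓ g := by
      have := h.mul_right_of_eq_zero (h0 _ _ h2) g
      rwa [mul_inv_cancel_left] at this
    simp only [cost, List.map_cons, List.sum_cons] at h5 ⊢
    omega

theorem norm_map_le {α β : Type*} [DecidableEq α] [DecidableEq β] (f : α → β) (w : FreeGroup α) :
    (FreeGroup.map f w).norm ≤ w.norm := by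
  conv_lhs => rw [← FreeGroup.mk_toWord (x := w), FreeGroup.map.mk]
  exact FreeGroup.norm_mk_le.trans (by simp [FreeGroup.norm])

/-- The retraction of the HNN extension of a free group along the trivial subgroup onto a free
group with one more basis element. -/
def toFreeGroupOption (ι : Type*) :
    HNNExtension (FreeGroup ι) ⊥ ⊥ (MulEquiv.refl _) →* FreeGroup (Option ι) :=
  lift (FreeGroup.map some) (FreeGroup.of none) fun a => by
    have : (a : FreeGroup ι) = 1 := Subgroup.mem_bot.1 a.2
    simp [this]

theorem norm_toFreeGroupOption_le {ι : Type*} [DecidableEq ι]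
    (r : ReducedWord (FreeGroup ι) ⊥ ⊥) :
    (toFreeGroupOption ι (r.prod (MulEquiv.refl _))).norm ≤ cost FreeGroup.norm r := by
  obtain ⟨g, l, hl⟩ := r
  simp only [ReducedWord.prod, cost, map_mul, map_list_prod, List.map_map]
  refine (FreeGroup.norm_mul_le _ _).trans (add_le_add ?_ ?_)
  · simpa [toFreeGroupOption] using norm_map_le some g
  · clear hl
    induction l with
    | nil => simp
    | cons x l ih =>
      obtain ⟨u, k⟩ := x
      simp only [List.map_cons, List.prod_cons, List.sum_cons]
      refine (FreeGroup.norm_mul_le _ _).trans (add_le_add ?_ ih)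
      simp only [Function.comp_apply, map_mul, map_zpow, toFreeGroupOption, lift_t, lift_of]
      refine (FreeGroup.norm_mul_le _ _).trans (add_le_add ?_ (norm_map_le some k))
      rcases Int.units_eq_one_or u with rfl | rfl <;> simp

/-- Suppose that a length function on `G` vanishes on the associated subgroups and detects the
family `f`. Then `f` together with the stable letter is an isometric family in the HNN extension.
Words in this family are reduced words of the HNN extension, since nontrivial elements of the
subgroup generated by `f` have positive length and so avoid the associated subgroups. -/
theorem isIsometricFamily_option {G : Type u} [Group G] {A B : Subgroup G} {φ : A ≃* B}
    {ℓ : G → ℕ} (h : IsLengthFunction ℓ) (hA : ∀ a ∈ A, ℓ a = 0) (hB : ∀ b ∈ B, ℓ b = 0)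
    {S : Set G} (hS : Subgroup.closure S = ⊤) (hS1 : ∀ x ∈ S, ℓ x ≤ 1)
    {ι : Type*} [DecidableEq ι] {f : ι → G} (hf : ∀ i, f i ∈ S)
    (hw : ∀ w : FreeGroup ι, w.norm ≤ ℓ (FreeGroup.lift f w)) :
    IsIsometricFamily (of '' S ∪ {t})
      (fun i : Option ι => i.elim (t : HNNExtension G A B φ) fun i => of (f i)) := by
  intro w
  have hT := closure_image_of_union_t (φ := φ) hS
  convert le_antisymm (wordLength_lift_le ?_ w) ?_
  · rintro (_ | i)
    · exact Or.inr rfl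
    · exact Or.inl ⟨_, hf i, rfl⟩
  obtain ⟨d⟩ := TransversalPair.nonempty (FreeGroup ι) (⊥ : Subgroup (FreeGroup ι)) ⊥
  -- a reduced word `r` over the free group that represents `w`
  let ψ : HNNExtension (FreeGroup ι) ⊥ ⊥ (MulEquiv.refl _) →* HNNExtension G A B φ :=
    lift (of.comp (FreeGroup.lift f)) t fun a => by
      have : (a : FreeGroup ι) = 1 := Subgroup.mem_bot.1 a.2
      simp [this]
  let θ : FreeGroup (Option ι) →* HNNExtension (FreeGroup ι) ⊥ ⊥ (MulEquiv.refl _) :=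
    FreeGroup.lift fun i => i.elim t fun i => of (FreeGroup.of i)
  have hθ : (toFreeGroupOption ι).comp θ = MonoidHom.id _ := by
    ext (_ | i) <;> simp [θ, toFreeGroupOption]
  have hψ : ψ.comp θ = FreeGroup.lift fun i : Option ι => i.elim t fun i => of (f i) := by
    ext (_ | i) <;> simp [θ, ψ]
  let r : ReducedWord (FreeGroup ι) ⊥ ⊥ := (θ w • (empty : NormalWord d)).toReducedWord
  have hr : r.prod (MulEquiv.refl _) = θ w := by
    simp [r, prod_smul]
  have h1 : w.norm ≤ cost FreeGroup.norm r := by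
    have := norm_toFreeGroupOption_le r
    rwa [hr, ← MonoidHom.comp_apply, hθ] at this
  let r' : ReducedWord G A B := ⟨FreeGroup.lift f r.head,
    r.toList.map fun x => (x.1, FreeGroup.lift f x.2), by
      rw [List.isChain_map]
      refine r.chain.imp fun x y hxy hx => hxy ?_
      have h0 : ℓ (FreeGroup.lift f x.2) = 0 := by
        rcases Int.units_eq_one_or x.1 with hu | hu <;> rw [hu] at hx
        exacts [hA _ hx, hB _ hx]
      have h2 : x.2 = 1 := FreeGroup.norm_eq_zero.1 (by have := hw x.2; omega)
      rw [h2]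
      exact one_mem _⟩
  have hr' : r'.prod φ = FreeGroup.lift (fun i : Option ι => i.elim t fun i => of (f i)) w := by
    rw [← hψ, MonoidHom.comp_apply, ← hr]
    simp [r', ψ, ReducedWord.prod, map_list_prod, Function.comp_def]
  have h2 : cost FreeGroup.norm r ≤ cost ℓ r' := by
    simp only [cost, r', List.map_map, Function.comp_def]
    exact add_le_add (hw _) (List.sum_le_sum fun x _ => Nat.add_le_add_left (hw _) 1)
  obtain ⟨l, hl, hp, hl'⟩ := exists_list_length_eq_wordLength hT
    (FreeGroup.lift (fun i : Option ι => i.elim t fun i => of (f i)) w)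
  obtain ⟨v, hv, hv'⟩ := exists_reducedWord_cost_le (φ := φ) h
    (fun a => by rw [hA _ a.2, hB _ (φ a).2]) hS1 l hl
  rw [cost_eq_of_prod_eq (φ := φ) h hA hB r' v (by rw [hv, hp, hr'])] at h2
  omega

end HNN

/-! ### Fundamental groups of graphs of groups -/

namespace GraphOfGroups

variable {V E : Type} (X : GraphOfGroups.{u} V E) (T : Set E)

/-- The canonical map from a vertex group to the fundamental group. -/
def toFundamentalGroup (v : V) : X.vertexGroup v →* X.FundamentalGroup T :=
  (QuotientGroup.mk' _).comp (X.ofVertex v)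

/-- The stable letter of an edge, in the fundamental group. -/
def stableLetter (e : E) : X.FundamentalGroup T :=
  QuotientGroup.mk' _ (X.stable e)

theorem toFundamentalGroup_sourceMap_mul (e : E) (h : X.edgeGroup e) :
    X.toFundamentalGroup T (X.source e) (X.sourceMap e h) * X.stableLetter T e =
      X.stableLetter T e * X.toFundamentalGroup T (X.target e) (X.targetMap e h) := by
  have : QuotientGroup.mk' (Subgroup.normalClosure (X.relators T)) _ = 1 :=
    (QuotientGroup.eq_one_iff _).2 (Subgroup.subset_normalClosure (Or.inl ⟨e, h, rfl⟩))
  simp only [map_mul, map_inv] at this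
  rw [mul_inv_eq_one, mul_assoc, inv_mul_eq_iff_eq_mul] at this
  exact this

theorem stableLetter_eq_one {e : E} (he : e ∈ T) : X.stableLetter T e = 1 :=
  (QuotientGroup.eq_one_iff _).2 (Subgroup.subset_normalClosure (Or.inr ⟨e, he, rfl⟩))

variable {T} {Q : Type*} [Group Q]

/-- Homomorphisms from a fundamental group, by generators and relations. -/
def lift (f : ∀ v, X.vertexGroup v →* Q) (y : E → Q)
    (hf : ∀ e h, f (X.source e) (X.sourceMap e h) * y e = y e * f (X.target e) (X.targetMap e h))
    (hy : ∀ e ∈ T, y e = 1) : X.FundamentalGroup T →* Q :=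
  QuotientGroup.lift _ (Monoid.Coprod.lift (Monoid.CoprodI.lift f) (FreeGroup.lift y)) <| by
    refine Subgroup.normalClosure_le_normal ?_
    rintro _ (⟨e, h, rfl⟩ | ⟨e, he, rfl⟩)
    · have := hf e h
      simp only [ofVertex, stable, SetLike.mem_coe, MonoidHom.mem_ker, map_mul, map_inv,
        MonoidHom.comp_apply, Monoid.Coprod.lift_apply_inl, Monoid.Coprod.lift_apply_inr,
        Monoid.CoprodI.lift_of,
        FreeGroup.lift_apply_of]
      rw [mul_inv_eq_one, mul_assoc, this, inv_mul_cancel_left]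
    · simp [stable, hy e he]

@[simp]
theorem lift_toFundamentalGroup (f : ∀ v, X.vertexGroup v →* Q) (y : E → Q) (hf)
    (hy : ∀ e ∈ T, y e = 1) (v : V) (g : X.vertexGroup v) :
    X.lift f y hf hy (X.toFundamentalGroup T v g) = f v g := by
  simp [lift, toFundamentalGroup, ofVertex]

@[simp]
theorem lift_stableLetter (f : ∀ v, X.vertexGroup v →* Q) (y : E → Q) (hf)
    (hy : ∀ e ∈ T, y e = 1) (e : E) :
    X.lift f y hf hy (X.stableLetter T e) = y e := by
  simp [lift, stableLetter, stable]

theorem hom_ext {f g : X.FundamentalGroup T →* Q}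
    (h : ∀ v x, f (X.toFundamentalGroup T v x) = g (X.toFundamentalGroup T v x))
    (h' : ∀ e, f (X.stableLetter T e) = g (X.stableLetter T e)) : f = g := by
  refine QuotientGroup.monoidHom_ext _ (Monoid.Coprod.hom_ext ?_ ?_)
  · ext v x
    exact h v x
  · ext e
    exact h' e

end GraphOfGroups

/-! ### HNN extensions and amalgams in a closed class -/

section Closed

variable {𝒢 : ∀ (G : Type u) [Group G], Prop} {G : Type u} [Group G] {S : Set G}
  {ι : Type u} {f g : ι → G}

/-- The isomorphism between the free subgroups with bases `f` and `g`. -/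
noncomputable def rangeEquiv (hf : Function.Injective (FreeGroup.lift f))
    (hg : Function.Injective (FreeGroup.lift g)) :
    (FreeGroup.lift f).range ≃* (FreeGroup.lift g).range :=
  (MonoidHom.ofInjective hf).symm.trans (MonoidHom.ofInjective hg)

theorem rangeEquiv_apply (hf : Function.Injective (FreeGroup.lift f))
    (hg : Function.Injective (FreeGroup.lift g)) (w : FreeGroup ι) :
    rangeEquiv hf hg ⟨FreeGroup.lift f w, w, rfl⟩ = ⟨FreeGroup.lift g w, w, rfl⟩ := by
  have : (⟨FreeGroup.lift f w, w, rfl⟩ : (FreeGroup.lift f).range) =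
    MonoidHom.ofInjective hf w := rfl
  rw [rangeEquiv, this, MulEquiv.trans_apply, MulEquiv.symm_apply_apply]
  rfl

theorem exists_eq_and_rangeEquiv_eq (hf : Function.Injective (FreeGroup.lift f))
    (hg : Function.Injective (FreeGroup.lift g)) (a : (FreeGroup.lift f).range) :
    ∃ w, (a : G) = FreeGroup.lift f w ∧ (rangeEquiv hf hg a : G) = FreeGroup.lift g w := by
  obtain ⟨_, w, rfl⟩ := a
  exact ⟨w, rfl, by rw [rangeEquiv_apply]⟩

/-- The one-loop graph of groups of an HNN extension. Mathlib's stable letter conjugates the first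
associated subgroup to the second, so `g` is the inclusion at the source. -/
def loopGraph (hf : Function.Injective (FreeGroup.lift f))
    (hg : Function.Injective (FreeGroup.lift g)) : GraphOfGroups.{u} Unit Unit where
  source _ := ()
  target _ := ()
  vertexGroup _ := G
  edgeGroup _ := FreeGroup ι
  sourceMap _ := FreeGroup.lift g
  targetMap _ := FreeGroup.lift f
  sourceMap_injective _ := hg
  targetMap_injective _ := hf

/-- The map from an HNN extension to the fundamental group of the one-loop graph of groups. -/
noncomputable def hnnToLoop (hf : Function.Injective (FreeGroup.lift f))
    (hg : Function.Injective (FreeGroup.lift g)) :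
    HNNExtension G _ _ (rangeEquiv hf hg) →* (loopGraph hf hg).FundamentalGroup ∅ :=
  HNNExtension.lift (G := G) ((loopGraph hf hg).toFundamentalGroup ∅ ())
    ((loopGraph hf hg).stableLetter ∅ ()) fun a => by
      obtain ⟨w, h1, h2⟩ := exists_eq_and_rangeEquiv_eq hf hg a
      rw [h1, h2]
      exact ((loopGraph hf hg).toFundamentalGroup_sourceMap_mul ∅ () w).symm

/-- The inverse of `hnnToLoop`. -/
noncomputable def loopToHNN (hf : Function.Injective (FreeGroup.lift f))
    (hg : Function.Injective (FreeGroup.lift g)) :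
    (loopGraph hf hg).FundamentalGroup ∅ →* HNNExtension G _ _ (rangeEquiv hf hg) :=
  (loopGraph hf hg).lift (fun _ => HNNExtension.of) (fun _ => HNNExtension.t)
    (fun _ w => by
      have := HNNExtension.t_mul_of (φ := rangeEquiv hf hg) ⟨FreeGroup.lift f w, w, rfl⟩
      have h := congrArg Subtype.val (rangeEquiv_apply hf hg w)
      exact ((congrArg (fun x => HNNExtension.of x * HNNExtension.t) h).symm.trans this.symm))
    (by simp)

/-- The HNN extension as the fundamental group of the one-loop graph of groups. -/
noncomputable def hnnEquiv (hf : Function.Injective (FreeGroup.lift f))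
    (hg : Function.Injective (FreeGroup.lift g)) :
    HNNExtension G _ _ (rangeEquiv hf hg) ≃* (loopGraph hf hg).FundamentalGroup ∅ :=
  have h1 (x : G) : hnnToLoop hf hg (HNNExtension.of x) =
    (loopGraph hf hg).toFundamentalGroup ∅ () x := HNNExtension.lift_of ..
  have h2 : hnnToLoop hf hg HNNExtension.t = (loopGraph hf hg).stableLetter ∅ () :=
    HNNExtension.lift_t ..
  have h3 (x : G) : loopToHNN hf hg ((loopGraph hf hg).toFundamentalGroup ∅ () x) =
    HNNExtension.of x := GraphOfGroups.lift_toFundamentalGroup ..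
  have h4 : loopToHNN hf hg ((loopGraph hf hg).stableLetter ∅ ()) = HNNExtension.t :=
    GraphOfGroups.lift_stableLetter ..
  MonoidHom.toMulEquiv (hnnToLoop hf hg) (loopToHNN hf hg)
    (HNNExtension.hom_ext (MonoidHom.ext fun x => (congrArg _ (h1 x)).trans (h3 x))
      ((congrArg _ h2).trans h4))
    ((loopGraph hf hg).hom_ext (fun _ x => (congrArg _ (h3 x)).trans (h1 x))
      (fun _ => (congrArg _ h4).trans h2))

theorem isSpanningTree_loopGraph (hf : Function.Injective (FreeGroup.lift f))
    (hg : Function.Injective (FreeGroup.lift g)) : (loopGraph hf hg).IsSpanningTree ∅ := by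
  refine ⟨by simp, by simp, ?_⟩
  simp only [Set.image_empty, SimpleGraph.fromEdgeSet_empty]
  exact SimpleGraph.IsTree.of_subsingleton

/-- A class closed under isometric amalgamation contains the HNN extensions along isometric free
subgroups. -/
theorem ClosedUnderIsometricFreeAmalgamation.hnn (h𝒢 : ClosedUnderIsometricFreeAmalgamation 𝒢)
    (hG : 𝒢 G) (hS : IsFiniteGeneratingSet S) [Finite ι] (hf : IsIsometricFamily S f)
    (hg : IsIsometricFamily S g) :
    𝒢 (HNNExtension G _ _ (rangeEquiv (hf.injective hS.2) (hg.injective hS.2))) := by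
  refine h𝒢 Unit Unit (loopGraph (hf.injective hS.2) (hg.injective hS.2)) ∅
    (isSpanningTree_loopGraph _ _) ?_ (fun _ => hG) (fun _ => ?_) _ ⟨hnnEquiv _ _⟩
  · exact ⟨fun _ => S, fun _ => Set.range FreeGroup.of, fun _ => hS,
      fun _ => ⟨Set.finite_range _, FreeGroup.closure_range_of ι⟩,
      fun _ => ⟨hg.isWordIsometry, hf.isWordIsometry⟩⟩
  · constructor
    · change Group.FG (FreeGroup ι)
      infer_instance
    · change IsFreeGroup (FreeGroup ι)
      infer_instance

/-- The graph of groups of the amalgam of two copies of `G` that identifies the family `f` in the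
copy `false` with the family `g` in the copy `true`. -/
def edgeGraph (hf : Function.Injective (FreeGroup.lift f))
    (hg : Function.Injective (FreeGroup.lift g)) : GraphOfGroups.{u} Bool Unit where
  source _ := false
  target _ := true
  vertexGroup _ := G
  edgeGroup _ := FreeGroup ι
  sourceMap _ := FreeGroup.lift f
  targetMap _ := FreeGroup.lift g
  sourceMap_injective _ := hf
  targetMap_injective _ := hg

theorem isSpanningTree_edgeGraph (hf : Function.Injective (FreeGroup.lift f))
    (hg : Function.Injective (FreeGroup.lift g)) :
    (edgeGraph hf hg).IsSpanningTree Set.univ := by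
  refine ⟨by simp [edgeGraph], Set.injOn_of_injective (Function.injective_of_subsingleton _), ?_⟩
  have : SimpleGraph.fromEdgeSet ((edgeGraph hf hg).ends '' Set.univ) = ⊤ := by
    ext x y
    simp only [SimpleGraph.fromEdgeSet_adj, SimpleGraph.top_adj, and_iff_right_iff_imp]
    intro h
    refine ⟨(), trivial, ?_⟩
    cases x <;> cases y <;> simp_all [GraphOfGroups.ends, edgeGraph, Sym2.eq_swap]
  rw [this, SimpleGraph.isTree_iff_connected_and_card]
  refine ⟨SimpleGraph.connected_top, ?_⟩
  rw [Nat.card_eq_fintype_card, ← SimpleGraph.edgeFinset_card,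
    SimpleGraph.card_edgeFinset_top_eq_card_choose_two]
  simp

/-- A class closed under isometric amalgamation contains the amalgams of two copies of a group
along isometric free subgroups. -/
theorem ClosedUnderIsometricFreeAmalgamation.amalgam
    (h𝒢 : ClosedUnderIsometricFreeAmalgamation 𝒢) (hG : 𝒢 G) (hS : IsFiniteGeneratingSet S)
    [Finite ι] (hf : IsIsometricFamily S f) (hg : IsIsometricFamily S g) :
    𝒢 ((edgeGraph (hf.injective hS.2) (hg.injective hS.2)).FundamentalGroup Set.univ) := by
  refine h𝒢 Bool Unit (edgeGraph (hf.injective hS.2) (hg.injective hS.2)) Set.univ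
    (isSpanningTree_edgeGraph _ _) ?_ (fun _ => hG) (fun _ => ?_) _ ⟨MulEquiv.refl _⟩
  · exact ⟨fun _ => S, fun _ => Set.range FreeGroup.of, fun _ => hS,
      fun _ => ⟨Set.finite_range _, FreeGroup.closure_range_of ι⟩,
      fun _ => ⟨hf.isWordIsometry, hg.isWordIsometry⟩⟩
  · constructor
    · change Group.FG (FreeGroup ι)
      infer_instance
    · change IsFreeGroup (FreeGroup ι)
      infer_instance

end Closed

/-! ### Adjoining stable letters -/

section Step

variable {𝒢 : ∀ (G : Type u) [Group G], Prop} {G : Type u} [Group G] {S : Set G}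
  {ι : Type u} {f g : ι → G}

/-- The properties of an HNN extension along isometric free subgroups that are used below: it is
in the class, the base group is isometric, the universal property, and the detection of families
containing the stable letter. -/
theorem ClosedUnderIsometricFreeAmalgamation.exists_hnn
    (h𝒢 : ClosedUnderIsometricFreeAmalgamation 𝒢) (hG : 𝒢 G) (hS : IsFiniteGeneratingSet S)
    [Finite ι] (hf : IsIsometricFamily S f) (hg : IsIsometricFamily S g) :
    ∃ (P : Type u) (_ : Group P) (i : G →* P) (t : P), 𝒢 P ∧
      (∀ S' : Set G, IsFiniteGeneratingSet S' → IsFiniteGeneratingSet (i '' S' ∪ {t})) ∧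
      (∀ x, wordLength (i '' S ∪ {t}) (i x) = wordLength S x) ∧
      (∀ k, t * i (f k) = i (g k) * t) ∧
      (∀ (Q : Type u) [Group Q] (h : G →* Q) (y : Q), (∀ k, y * h (f k) = h (g k) * y) →
        ∃ h' : P →* Q, (∀ x, h' (i x) = h x) ∧ h' t = y) ∧
      ∀ ℓ : G → ℕ, IsLengthFunction ℓ → (∀ w, ℓ (FreeGroup.lift f w) = 0) →
        (∀ w, ℓ (FreeGroup.lift g w) = 0) →
        ∀ S' : Set G, Subgroup.closure S' = ⊤ → (∀ x ∈ S', ℓ x ≤ 1) →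
        ∀ (κ : Type u) [DecidableEq κ] (d : κ → G), (∀ k, d k ∈ S') →
        (∀ w : FreeGroup κ, w.norm ≤ ℓ (FreeGroup.lift d w)) →
        IsIsometricFamily (i '' S' ∪ {t}) fun k : Option κ => k.elim t fun k => i (d k) := by
  have hf' := hf.injective hS.2
  have hg' := hg.injective hS.2
  refine ⟨HNNExtension G _ _ (rangeEquiv hf' hg'), inferInstance, HNNExtension.of,
    HNNExtension.t, h𝒢.hnn hG hS hf hg, ?_, ?_, ?_, ?_, ?_⟩
  · exact fun S' hS' => ⟨(hS'.1.image _).union (Set.finite_singleton _),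
      closure_image_of_union_t hS'.2⟩
  · refine wordLength_of hS.2 fun a => ?_
    obtain ⟨w, h1, h2⟩ := exists_eq_and_rangeEquiv_eq hf' hg' a
    rw [h1, h2, hf, hg]
  · intro k
    have h1 := HNNExtension.t_mul_of (φ := rangeEquiv hf' hg')
      ⟨FreeGroup.lift f (FreeGroup.of k), FreeGroup.of k, rfl⟩
    rw [rangeEquiv_apply] at h1
    simpa using h1
  · intro Q _ h y hy
    refine ⟨HNNExtension.lift h y fun a => ?_, HNNExtension.lift_of _ _ _,
      HNNExtension.lift_t _ _ _⟩
    obtain ⟨w, h1, h2⟩ := exists_eq_and_rangeEquiv_eq hf' hg' a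
    rw [h1, h2]
    have h3 : (MulAut.conj y).toMonoidHom.comp (h.comp (FreeGroup.lift f)) =
        h.comp (FreeGroup.lift g) := by
      ext k
      simp [hy]
    have h4 := DFunLike.congr_fun h3 w
    simp only [MonoidHom.comp_apply, MulEquiv.coe_toMonoidHom, MulAut.conj_apply] at h4
    rw [← h4, inv_mul_cancel_right]
  · intro ℓ h h1 h2 S' hS' hS1 κ _ d hd hw
    refine isIsometricFamily_option h ?_ ?_ hS' hS1 hd hw
    · rintro _ ⟨w, rfl⟩
      exact h1 w
    · rintro _ ⟨w, rfl⟩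
      exact h2 w

end Step

section Cyclic

variable {G : Type u} [Group G] {S : Set G}

theorem norm_of_zpow {α : Type*} [DecidableEq α] (a : α) (n : ℤ) :
    (FreeGroup.of a ^ n).norm = n.natAbs := by
  obtain ⟨k, rfl | rfl⟩ := n.eq_nat_or_neg <;> simp

theorem exists_eq_of_zpow (w : FreeGroup PUnit.{u + 1}) :
    ∃ n : ℤ, w = FreeGroup.of PUnit.unit ^ n := by
  have : w ∈ Subgroup.closure (Set.range FreeGroup.of) := by
    rw [FreeGroup.closure_range_of]; trivial
  rw [Set.range_unique] at this
  obtain ⟨n, hn⟩ := Subgroup.mem_closure_singleton.1 this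
  exact ⟨n, hn.symm⟩

theorem isIsometricFamily_of_zpow (hS : Subgroup.closure S = ⊤) {a : G} (ha : a ∈ S) {ℓ : G → ℕ}
    (h : IsLengthFunction ℓ) {N : ℕ} (hN : 0 < N) (hSN : ∀ x ∈ S, ℓ x ≤ N)
    (hw : ∀ n : ℤ, N * n.natAbs ≤ ℓ (a ^ n)) :
    IsIsometricFamily S fun _ : PUnit.{u + 1} => a := by
  refine isIsometricFamily_of_isLengthFunction hS (fun _ => ha) h hN hSN fun w => ?_
  obtain ⟨n, rfl⟩ := exists_eq_of_zpow w
  rw [norm_of_zpow]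
  simpa using hw n

theorem IsIsometricFamily.map {H : Type u} [Group H] {T : Set H} {ι : Type*} {f : ι → G}
    (hf : IsIsometricFamily S f) (i : G →* H) (hi : ∀ x, wordLength T (i x) = wordLength S x) :
    IsIsometricFamily T fun k => i (f k) := by
  intro w
  rw [← hf w, ← hi]
  congr 1
  have : FreeGroup.lift (fun k => i (f k)) = i.comp (FreeGroup.lift f) := by ext; simp
  rw [this]
  rfl

/-- The infinite cyclic group, in the universe of the groups at hand. -/
abbrev IntGroup : Type u := ULift.{u} (Multiplicative ℤ)

/-- The element of the infinite cyclic group given by an integer. -/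
def intElt (n : ℤ) : IntGroup.{u} := ⟨Multiplicative.ofAdd n⟩

/-- The absolute value on the infinite cyclic group. -/
def intLength (x : IntGroup.{u}) : ℕ := (Multiplicative.toAdd x.down).natAbs

theorem isLengthFunction_intLength : IsLengthFunction intLength.{u} :=
  ⟨rfl, fun _ _ => Int.natAbs_add_le _ _, fun _ => Int.natAbs_neg _⟩

@[simp]
theorem intLength_intElt (n : ℤ) : intLength (intElt.{u} n) = n.natAbs := rfl

theorem intElt_mul (m n : ℤ) : intElt.{u} m * intElt n = intElt (m + n) := rfl

theorem intElt_zpow (m n : ℤ) : intElt.{u} m ^ n = intElt (n * m) := by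
  apply ULift.ext
  exact (ofAdd_zsmul n m).symm.trans (by rw [smul_eq_mul]; rfl)

theorem intElt_pow (m : ℤ) (n : ℕ) : intElt.{u} m ^ n = intElt (n * m) := by
  rw [← zpow_natCast, intElt_zpow]

@[simp]
theorem intLength_one : intLength.{u} 1 = 0 := rfl

end Cyclic

/-! ### The undetectable elements -/

section Gadget

variable {𝒢 : ∀ (G : Type u) [Group G], Prop} {G : Type u} [Group G] {S : Set G}

theorem isIsometricFamily_pempty (hS : IsFiniteGeneratingSet S) (f : PEmpty.{u + 1} → G) :
    IsIsometricFamily S f := fun w => by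
  rw [Subsingleton.elim w 1, map_one, (isLengthFunction_wordLength hS.2).map_one]
  exact (@FreeGroup.norm_one _ (Classical.decEq _)).symm

theorem closure_eq_top_mono {S T : Set G} (hS : Subgroup.closure S = ⊤) (h : S ⊆ T) :
    Subgroup.closure T = ⊤ :=
  top_le_iff.1 (hS ▸ Subgroup.closure_mono h)

/-- The free product of `G` with a free abelian group with basis `a`, `b`. For a suitable
generating set, the three cyclic subgroups generated by `a`, `b` and `(a * b) ^ p` are isometric. -/
theorem ClosedUnderIsometricFreeAmalgamation.exists_commuting
    (h𝒢 : ClosedUnderIsometricFreeAmalgamation 𝒢) (hG : 𝒢 G) (hS : IsFiniteGeneratingSet S)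
    {p : ℕ} (hp : 0 < p) :
    ∃ (M : Type u) (_ : Group M) (i : G →* M) (a b : M), 𝒢 M ∧ a * b = b * a ∧
      (∀ (Q : Type u) [Group Q] (h : G →* Q) (a' b' : Q), a' * b' = b' * a' →
        ∃ h' : M →* Q, (∀ x, h' (i x) = h x) ∧ h' a = a' ∧ h' b = b') ∧
      IsFiniteGeneratingSet (i '' S ∪ {a, b, (a * b) ^ p}) ∧
      IsIsometricFamily (i '' S ∪ {a, b, (a * b) ^ p}) (fun _ : PUnit.{u + 1} => a) ∧
      IsIsometricFamily (i '' S ∪ {a, b, (a * b) ^ p}) (fun _ : PUnit.{u + 1} => b) ∧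
      IsIsometricFamily (i '' S ∪ {a, b, (a * b) ^ p})
        (fun _ : PUnit.{u + 1} => (a * b) ^ p) := by
  obtain ⟨M₁, _, i₁, a, hM₁, hgen₁, -, -, hlift₁, -⟩ :=
    h𝒢.exists_hnn hG hS (isIsometricFamily_pempty hS PEmpty.elim)
      (isIsometricFamily_pempty hS PEmpty.elim)
  specialize hgen₁ S hS
  have ha : IsIsometricFamily (i₁ '' S ∪ {a}) (fun _ : PUnit.{u + 1} => a) := by
    obtain ⟨ρ, h1, h2⟩ := hlift₁ IntGroup 1 (intElt 1) (fun k => k.elim)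
    refine isIsometricFamily_of_zpow hgen₁.2 (Or.inr rfl)
      (isLengthFunction_intLength.comp ρ) one_pos ?_ fun n => ?_
    · rintro _ (⟨x, -, rfl⟩ | rfl)
      · simp [h1]
      · simp [h2]
    · simp [h2, intElt_zpow]
  obtain ⟨M, _, i₂, b, hM, hgen₂, -, hab, hlift₂, -⟩ := h𝒢.exists_hnn hM₁ hgen₁ ha ha
  specialize hgen₂ _ hgen₁
  have hgen : IsFiniteGeneratingSet ((i₂.comp i₁) '' S ∪ {i₂ a, b, (i₂ a * b) ^ p}) := by
    refine ⟨(hS.1.image _).union (by simp), closure_eq_top_mono hgen₂.2 ?_⟩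
    rintro _ (⟨_, ⟨x, hx, rfl⟩ | rfl, rfl⟩ | rfl)
    · exact Or.inl ⟨x, hx, rfl⟩
    · simp
    · simp
  have hlift : ∀ (Q : Type u) [Group Q] (h : G →* Q) (a' b' : Q), a' * b' = b' * a' →
      ∃ h' : M →* Q, (∀ x, h' (i₂.comp i₁ x) = h x) ∧ h' (i₂ a) = a' ∧ h' b = b' := by
    intro Q _ h a' b' hab'
    obtain ⟨ρ, h1, h2⟩ := hlift₁ Q h a' (fun k => k.elim)
    obtain ⟨σ, h3, h4⟩ := hlift₂ Q ρ b' (fun _ => by rw [h2, hab'])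
    exact ⟨σ, fun x => by rw [MonoidHom.comp_apply, h3, h1], by rw [h3, h2], h4⟩
  -- The homomorphism to `ℤ` killing `G`, with `a ↦ m` and `b ↦ n`, detects an element of the
  -- generating set if none of the other generators has a larger image.
  have hdetect : ∀ (m n : ℤ) (N : ℕ), 0 < N → m.natAbs ≤ N → n.natAbs ≤ N →
      ((p : ℤ) * (m + n)).natAbs ≤ N → ∀ y ∈ ({i₂ a, b, (i₂ a * b) ^ p} : Set M),
      (∀ σ : M →* IntGroup.{u}, σ (i₂ a) = intElt m → σ b = intElt n →
        N ≤ intLength (σ y)) →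
      IsIsometricFamily ((i₂.comp i₁) '' S ∪ {i₂ a, b, (i₂ a * b) ^ p})
        (fun _ : PUnit.{u + 1} => y) := by
    intro m n N hN hm hn hmn y hy hσ
    obtain ⟨σ, h1, h2, h3⟩ := hlift IntGroup 1 (intElt m) (intElt n) (mul_comm _ _)
    specialize hσ σ h2 h3
    refine isIsometricFamily_of_zpow hgen.2 (Or.inr hy) (isLengthFunction_intLength.comp σ) hN
      ?_ fun k => ?_
    · rintro _ (⟨x, -, rfl⟩ | rfl | rfl | rfl)
      · simp only [h1, MonoidHom.one_apply, intLength_one, zero_le]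
      · simpa [h2]
      · simpa [h3]
      · simpa [h2, h3, intElt_mul, intElt_pow] using hmn
    · obtain ⟨l, hl⟩ : ∃ l, σ y = intElt l := ⟨_, rfl⟩
      simp only [hl, map_zpow, intElt_zpow, intLength_intElt, Int.natAbs_mul] at hσ ⊢
      rw [mul_comm]
      exact Nat.mul_le_mul_left _ hσ
  refine ⟨M, inferInstance, i₂.comp i₁, i₂ a, b, hM, (hab ⟨⟩).symm, hlift, hgen, ?_, ?_, ?_⟩
  · exact hdetect 1 (-1) 1 one_pos (by simp) (by simp) (by simp) _ (by simp)
      fun σ h _ => by simp [h]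
  · exact hdetect (-1) 1 1 one_pos (by simp) (by simp) (by simp) _ (by simp)
      fun σ _ h => by simp [h]
  · exact hdetect 1 0 p hp (by simpa using Nat.one_le_iff_ne_zero.2 hp.ne') (by simp)
      (by simp) _ (by simp)
      fun σ h h' => by simp [h, h', intElt_mul, intElt_pow]

/-- The group obtained from the free product of `G` with the free abelian group on `a` and `b` by
adjoining `s` conjugating `a` to `(a * b) ^ p`, and `x` commuting with `a`. The cyclic subgroups
generated by `b` and `(a * b) ^ p` remain isometric, since base groups of isometric HNN extensions
are isometric. -/
theorem ClosedUnderIsometricFreeAmalgamation.exists_gadget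
    (h𝒢 : ClosedUnderIsometricFreeAmalgamation 𝒢) (hG : 𝒢 G) (hS : IsFiniteGeneratingSet S)
    {p : ℕ} (hp : 0 < p) :
    ∃ (M : Type u) (_ : Group M) (i : G →* M) (a b s x : M), 𝒢 M ∧ a * b = b * a ∧
      s * a = (a * b) ^ p * s ∧ x * a = a * x ∧
      (∀ (Q : Type u) [Group Q] (h : G →* Q) (a' b' s' x' : Q), a' * b' = b' * a' →
        s' * a' = (a' * b') ^ p * s' → x' * a' = a' * x' →
        ∃ h' : M →* Q, (∀ y, h' (i y) = h y) ∧ h' a = a' ∧ h' b = b' ∧ h' s = s' ∧ h' x = x') ∧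
      IsFiniteGeneratingSet (i '' S ∪ {a, b, s, x}) ∧
      ∃ T : Set M, IsFiniteGeneratingSet T ∧
        IsIsometricFamily T (fun _ : PUnit.{u + 1} => b) ∧
        IsIsometricFamily T (fun _ : PUnit.{u + 1} => (a * b) ^ p) := by
  obtain ⟨M₂, _, i₂, a, b, hM₂, hab, hlift₂, hgen₂, ha, hb, hc⟩ := h𝒢.exists_commuting hG hS hp
  obtain ⟨M₃, _, i₃, s, hM₃, hgen₃, hiso₃, hs, hlift₃, -⟩ := h𝒢.exists_hnn hM₂ hgen₂ ha hc
  specialize hgen₃ _ hgen₂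
  obtain ⟨M, _, i₄, x, hM, hgen₄, hiso₄, hx, hlift₄, -⟩ :=
    h𝒢.exists_hnn hM₃ hgen₃ (ha.map i₃ hiso₃) (ha.map i₃ hiso₃)
  specialize hgen₄ _ hgen₃
  have hs := hs ⟨⟩
  have hx := hx ⟨⟩
  refine ⟨M, inferInstance, i₄.comp (i₃.comp i₂), i₄ (i₃ a), i₄ (i₃ b), i₄ s, x, hM, ?_, ?_, hx,
    ?_, ?_, _, hgen₄, (hb.map i₃ hiso₃).map i₄ hiso₄, ?_⟩
  · simp only [← map_mul, hab]
  · simp only [← map_mul, ← map_pow, hs]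
  · intro Q _ h a' b' s' x' h1 h2 h3
    obtain ⟨ρ, r1, r2, r3⟩ := hlift₂ Q h a' b' h1
    obtain ⟨σ, s1, s2⟩ := hlift₃ Q ρ s' (fun _ => by simp only [map_pow, map_mul, r2, r3, h2])
    obtain ⟨τ, t1, t2⟩ := hlift₄ Q σ x' (fun _ => by simp only [s1, r2, h3])
    exact ⟨τ, fun y => by simp only [MonoidHom.comp_apply, t1, s1, r1], by rw [t1, s1, r2],
      by rw [t1, s1, r3], by rw [t1, s2], t2⟩
  · refine ⟨(hS.1.image _).union (by simp), ?_⟩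
    rw [eq_top_iff, ← hgen₄.2, Subgroup.closure_le]
    set K := Subgroup.closure
      ((i₄.comp (i₃.comp i₂)) '' S ∪ {i₄ (i₃ a), i₄ (i₃ b), i₄ s, x}) with hK
    have hK' : ∀ y ∈ (i₄.comp (i₃.comp i₂)) '' S ∪ {i₄ (i₃ a), i₄ (i₃ b), i₄ s, x}, y ∈ K :=
      fun y hy => Subgroup.subset_closure hy
    have h1 : i₄ (i₃ a) ∈ K := hK' _ (by simp)
    have h2 : i₄ (i₃ b) ∈ K := hK' _ (by simp)
    rintro _ (⟨_, ⟨_, ⟨y, hy, rfl⟩ | rfl | rfl | rfl, rfl⟩ | rfl, rfl⟩ | rfl)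
    · exact hK' _ (Or.inl ⟨y, hy, rfl⟩)
    · exact h1
    · exact h2
    · simp only [map_pow, map_mul]
      exact pow_mem (mul_mem h1 h2) p
    · exact hK' _ (by simp)
    · exact hK' _ (by simp)
  · have := (hc.map i₃ hiso₃).map i₄ hiso₄
    simpa only [map_pow, map_mul] using this

end Gadget

/-- In a finite group, `a * b` has the same order as its `p`-th power, which is conjugate both to
`a` and to `b`. Hence `a * b` is a power of `(a * b) ^ p`, so its conjugate by `s` is a power
of `a`. -/
theorem commute_of_finite {Q : Type*} [Group Q] [Finite Q] {a b s t x : Q} {p : ℕ}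
    (hab : a * b = b * a) (hs : s * a = (a * b) ^ p * s) (ht : t * b = (a * b) ^ p * t)
    (hx : x * a = a * x) : Commute (s⁻¹ * (a * b) * s) x := by
  have hs' : (a * b) ^ p = s * a * s⁻¹ := by rw [hs, mul_inv_cancel_right]
  have ht' : (a * b) ^ p = t * b * t⁻¹ := by rw [ht, mul_inv_cancel_right]
  have h1 : orderOf a = orderOf ((a * b) ^ p) := by
    rw [hs', ← MulAut.conj_apply, MulEquiv.orderOf_eq]
  have h2 : orderOf b = orderOf ((a * b) ^ p) := by
    rw [ht', ← MulAut.conj_apply, MulEquiv.orderOf_eq]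
  have h3 : orderOf (a * b) = orderOf ((a * b) ^ p) := by
    refine Nat.dvd_antisymm (orderOf_dvd_of_pow_eq_one ?_) (orderOf_pow_dvd p)
    rw [Commute.mul_pow hab, ← h1, pow_orderOf_eq_one, h1, ← h2, pow_orderOf_eq_one, one_mul]
  have h4 : Subgroup.zpowers ((a * b) ^ p) = Subgroup.zpowers (a * b) := by
    refine Subgroup.eq_of_le_of_card_ge
      (Subgroup.zpowers_le.2 (pow_mem (Subgroup.mem_zpowers _) p)) ?_
    rw [Nat.card_zpowers, Nat.card_zpowers, h3]
  have h5 : a * b ∈ Subgroup.zpowers ((a * b) ^ p) := h4 ▸ Subgroup.mem_zpowers _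
  obtain ⟨n, hn⟩ := Subgroup.mem_zpowers_iff.1 h5
  have h6 : s⁻¹ * (a * b) * s = a ^ n := by
    rw [← hn, hs', conj_zpow]
    group
  rw [h6]
  exact (Commute.zpow_right (show Commute x a from hx) n).symm

/-! ### Detection in a wreath product -/

section Wreath

variable {I : Type u} {C : Type}

/-- The length function on a wreath product with a finite group that takes the maximum of the
norms of all coordinates and ignores the permutation part. -/
def wreathLength [DecidableEq I] [Fintype C] (w : FreeGroup I ≀ᵣ C) : ℕ :=
  Finset.univ.sup fun c => (w.left c).norm

theorem norm_left_le_wreathLength [DecidableEq I] [Fintype C] (w : FreeGroup I ≀ᵣ C) (c : C) :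
    (w.left c).norm ≤ wreathLength w :=
  Finset.le_sup (f := fun c => (w.left c).norm) (Finset.mem_univ c)

theorem wreathLength_le [DecidableEq I] [Fintype C] {w : FreeGroup I ≀ᵣ C} {n : ℕ}
    (h : ∀ c, (w.left c).norm ≤ n) :
    wreathLength w ≤ n :=
  Finset.sup_le fun c _ => h c

theorem isLengthFunction_wreathLength [DecidableEq I] [Group C] [Fintype C] :
    IsLengthFunction (wreathLength : FreeGroup I ≀ᵣ C → ℕ) where
  map_one := Nat.le_zero.1 (wreathLength_le fun c => by simp)
  map_mul_le v w := wreathLength_le fun c => (FreeGroup.norm_mul_le _ _).trans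
    (add_le_add (norm_left_le_wreathLength v c) (norm_left_le_wreathLength w _))
  map_inv := by
    have key : ∀ w : FreeGroup I ≀ᵣ C, wreathLength w⁻¹ ≤ wreathLength w := fun w =>
      wreathLength_le fun c => by
        change ((w.left _)⁻¹).norm ≤ _
        rw [FreeGroup.norm_inv_eq]
        exact norm_left_le_wreathLength w _
    exact fun w => le_antisymm (key w) (by simpa using key w⁻¹)

/-- Elements of the base group whose coordinate at `1` runs through the basis are detected by the
length. -/
theorem norm_le_wreathLength_lift [DecidableEq I] [Group C] [Fintype C] {F : I → FreeGroup I ≀ᵣ C}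
    (h1 : ∀ i, (F i).right = 1) (h2 : ∀ i, (F i).left 1 = FreeGroup.of i) (w : FreeGroup I) :
    w.norm ≤ wreathLength (FreeGroup.lift F w) := by
  suffices h : (FreeGroup.lift F w).right = 1 ∧ (FreeGroup.lift F w).left 1 = w by
    conv_lhs => rw [← h.2]
    exact norm_left_le_wreathLength _ _
  induction w using FreeGroup.induction_on with
  | C1 => simp
  | of i => simp [h1, h2]
  | inv_of i _ => simp [h1, h2]
  | mul v w hv hw => simp [hv.1, hv.2, hw.1, hw.2]

variable {N : ℕ} {ν : I → ℕ}

/-- The coordinates of the image of `x` in the wreath product: the basis is placed at the negatives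
of the odd residues `2 * ν i + 1`, and all other coordinates are trivial. -/
noncomputable def coordinates (N : ℕ) (ν : I → ℕ) :
    Multiplicative (ZMod (2 * N)) → FreeGroup I :=
  Function.extend (fun i => Multiplicative.ofAdd (-((2 * ν i + 1 : ℕ) : ZMod (2 * N))))
    FreeGroup.of 1

theorem coordinates_apply (hν : Function.Injective ν) (hνN : ∀ i, ν i < N) (i : I) :
    coordinates N ν (Multiplicative.ofAdd (-((2 * ν i + 1 : ℕ) : ZMod (2 * N)))) =
      FreeGroup.of i := by
  refine Function.Injective.extend_apply (fun i j hij => hν ?_) _ _ i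
  have h1 : ((2 * ν i + 1 : ℕ) : ZMod (2 * N)) = ((2 * ν j + 1 : ℕ) : ZMod (2 * N)) :=
    neg_injective (Multiplicative.ofAdd.injective hij)
  rw [ZMod.natCast_eq_natCast_iff] at h1
  have := Nat.ModEq.eq_of_lt_of_lt h1 (by have := hνN i; omega) (by have := hνN j; omega)
  omega

theorem norm_coordinates_le [DecidableEq I] (c : Multiplicative (ZMod (2 * N))) :
    (coordinates N ν c).norm ≤ 1 := by
  rw [coordinates, Function.extend]
  split_ifs <;> simp

/-- All coordinates with even index are trivial. -/
theorem coordinates_eq_one (c : Multiplicative (ZMod (2 * N)))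
    (hc : ZMod.castHom (dvd_mul_right 2 N) (ZMod 2) (Multiplicative.toAdd c) = 0) :
    coordinates N ν c = 1 := by
  refine Function.extend_apply' _ _ _ ?_
  rintro ⟨i, rfl⟩
  rw [toAdd_ofAdd, map_neg, map_natCast, neg_eq_zero, ZMod.natCast_eq_zero_iff] at hc
  omega

/-- The generator of the acting cyclic group. -/
def shift (I : Type u) (N : ℕ) : FreeGroup I ≀ᵣ Multiplicative (ZMod (2 * N)) :=
  RegularWreathProduct.inl (Multiplicative.ofAdd 1)

theorem shift_pow (j : ℕ) :
    shift I N ^ j = RegularWreathProduct.inl (Multiplicative.ofAdd (j : ZMod (2 * N))) := by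
  rw [shift, ← map_pow, ← ofAdd_nsmul, nsmul_one]

/-- The image of `x` in the wreath product. -/
noncomputable def coordElt (N : ℕ) (ν : I → ℕ) :
    FreeGroup I ≀ᵣ Multiplicative (ZMod (2 * N)) :=
  ⟨coordinates N ν, 1⟩

theorem conj_coordElt (j : ℕ) :
    shift I N ^ j * coordElt N ν * (shift I N ^ j)⁻¹ =
      ⟨fun c => coordinates N ν (Multiplicative.ofAdd (-(j : ZMod (2 * N))) * c), 1⟩ := by
  rw [shift_pow]
  ext c
  · simp [coordElt, ofAdd_neg]
  · simp [coordElt]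

theorem commutator_coordElt (j : ℕ) :
    shift I N ^ j * coordElt N ν * (shift I N ^ j)⁻¹ * (coordElt N ν)⁻¹ =
      ⟨fun c => coordinates N ν (Multiplicative.ofAdd (-(j : ZMod (2 * N))) * c) *
        (coordinates N ν c)⁻¹, 1⟩ := by
  rw [conj_coordElt]
  ext c
  · simp [coordElt]
  · simp [coordElt]

theorem norm_commutator_le [DecidableEq I] (i : I) (c : Multiplicative (ZMod (2 * N))) :
    (coordinates N ν (Multiplicative.ofAdd (-((2 * ν i + 1 : ℕ) : ZMod (2 * N))) * c) *
        (coordinates N ν c)⁻¹).norm ≤ 1 := by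
  -- since `2 * ν i + 1` is odd, one of the two coordinates has an even index
  have h1 : ZMod.castHom (dvd_mul_right 2 N) (ZMod 2) ((2 * ν i + 1 : ℕ) : ZMod (2 * N)) = 1 := by
    rw [map_natCast, Nat.cast_add, Nat.cast_mul]
    have : ((2 : ℕ) : ZMod 2) = 0 := rfl
    rw [this, zero_mul, zero_add, Nat.cast_one]
  have h2 : ∀ y : ZMod 2, y = 0 ∨ y = 1 := by decide
  rcases h2 (ZMod.castHom (dvd_mul_right 2 N) (ZMod 2) (Multiplicative.toAdd c)) with hc | hc
  · rw [coordinates_eq_one c hc, inv_one, mul_one]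
    exact norm_coordinates_le _
  · rw [coordinates_eq_one (Multiplicative.ofAdd (-((2 * ν i + 1 : ℕ) : ZMod (2 * N))) * c),
      one_mul, FreeGroup.norm_inv_eq]
    · exact norm_coordinates_le _
    · rw [toAdd_mul, toAdd_ofAdd, map_add, map_neg, h1, hc, neg_add_cancel]

end Wreath

/-! ### The amalgamated factor -/

section Factor

theorem wreathLength_inl {I : Type u} [DecidableEq I] {C : Type} [Group C] [Fintype C] (c : C) :
    wreathLength (RegularWreathProduct.inl c : FreeGroup I ≀ᵣ C) = 0 :=
  Nat.le_zero.1 (wreathLength_le fun c => by simp)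

theorem IsIsometricFamily.comp_equiv {G : Type u} [Group G] {S : Set G} {ι : Type*} {f : ι → G}
    (hf : IsIsometricFamily S f) (e : ι ≃ ι) : IsIsometricFamily S fun k => f (e k) := by
  classical
  intro w
  have h : FreeGroup.lift (fun k => f (e k)) w = FreeGroup.lift f (FreeGroup.map e w) :=
    DFunLike.congr_fun (show FreeGroup.lift (fun k => f (e k)) =
      (FreeGroup.lift f).comp (FreeGroup.map e) from FreeGroup.ext_hom _ _ fun k => by simp) w
  rw [h, hf]
  convert le_antisymm (norm_map_le e w) ?_
  have := norm_map_le e.symm (FreeGroup.map e w)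
  rwa [FreeGroup.map.comp, e.symm_comp_self, FreeGroup.map.id] at this

/-- The involution that exchanges the generators, indexed by `Option κ` with `none` for the last
stable letter, with as many undetectable elements. -/
def swapEquiv (κ : Type*) : Option (κ ⊕ Option κ) ≃ Option (κ ⊕ Option κ) where
  toFun
    | none => some (Sum.inr none)
    | some (Sum.inl k) => some (Sum.inr (some k))
    | some (Sum.inr none) => none
    | some (Sum.inr (some k)) => some (Sum.inl k)
  invFun
    | none => some (Sum.inr none)
    | some (Sum.inl k) => some (Sum.inr (some k))
    | some (Sum.inr none) => none
    | some (Sum.inr (some k)) => some (Sum.inl k)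
  left_inv := by rintro (_ | _ | _ | _) <;> rfl
  right_inv := by rintro (_ | _ | _ | _) <;> rfl

variable {𝒢 : ∀ (G : Type u) [Group G], Prop} {G : Type u} [Group G] {S : Set G}

/-- The group `G` is a retract of a group `P` in the class that has two isometric families
`f` and `f ∘ e` with the following property: if two homomorphisms from `P` to a finite group
intertwine the two families, then both are trivial. -/
theorem ClosedUnderIsometricFreeAmalgamation.exists_factor
    (h𝒢 : ClosedUnderIsometricFreeAmalgamation 𝒢) (hG : 𝒢 G) (hS : IsFiniteGeneratingSet S) :
    ∃ (P : Type u) (_ : Group P) (i : G →* P) (r : P →* G) (T : Set P) (J : Type u) (f : J → P)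
      (e : J ≃ J), 𝒢 P ∧ (∀ g, r (i g) = g) ∧ IsFiniteGeneratingSet T ∧ Finite J ∧
        IsIsometricFamily T f ∧ IsIsometricFamily T (fun j => f (e j)) ∧
        ∀ (Q : Type u) [Group Q] [Finite Q] (q₁ q₂ : P →* Q), (∀ j, q₁ (f j) = q₂ (f (e j))) →
          (∀ y, q₁ y = 1) ∧ ∀ y, q₂ y = 1 := by
  classical
  have : Finite S := hS.1
  let κ : Type u := S ⊕ Fin 3
  let I : Type u := κ ⊕ Option κ
  let N := Nat.card I
  have hN : 0 < N := Nat.card_pos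
  have : NeZero (2 * N) := ⟨by omega⟩
  let ν : I → ℕ := fun k => (Finite.equivFin I k : ℕ)
  have hν : Function.Injective ν := Fin.val_injective.comp (Finite.equivFin I).injective
  have hνN : ∀ k, ν k < N := fun k => (Finite.equivFin I k).2
  obtain ⟨M, _, i, a, b, s, x, hM, hab, hs, hx, hlift, hgen, T₀, hT₀, hb, hc⟩ :=
    h𝒢.exists_gadget hG hS (p := 2 * N) (by omega)
  -- The exponent `p` is `2 * N`, even so that residues modulo `p` have a parity. Mapping `a` to `1`
  -- and `b` to an element of order `p` respects the relations.
  obtain ⟨ρ, ρi, ρa, ρb, ρs, ρx⟩ := hlift (FreeGroup I ≀ᵣ Multiplicative (ZMod (2 * N))) 1 1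
    (shift I N) 1 (coordElt N ν) (by simp) (by
      rw [one_mul, one_mul, mul_one, shift_pow, ZMod.natCast_self, ofAdd_zero, map_one]) (by simp)
  -- the generators `γ` of `M` and the family `d * γ`, where `d` is undetectable
  let γ : I → M := Sum.elim (Sum.elim (fun g => i g) ![a, s, x]) fun _ => 1
  let u : M := s⁻¹ * (a * b) * s
  let f₀ : I → M := fun k => u ^ (2 * ν k + 1) * x * (u ^ (2 * ν k + 1))⁻¹ * x⁻¹ * γ k
  have ρu : ρ u = shift I N := by simp [u, ρa, ρb, ρs]
  have ργ : ∀ k, ρ (γ k) = 1 ∨ ρ (γ k) = coordElt N ν := by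
    rintro ((g | k) | k)
    · exact Or.inl (ρi g)
    · fin_cases k
      exacts [Or.inl ρa, Or.inl ρs, Or.inr ρx]
    · exact Or.inl (map_one _)
  have ρf : ∀ k, (ρ (f₀ k)).right = 1 ∧ (ρ (f₀ k)).left 1 = FreeGroup.of k ∧
      wreathLength (ρ (f₀ k)) ≤ 1 := by
    intro k
    rcases ργ k with h | h
    · have h1 : ρ (f₀ k) = shift I N ^ (2 * ν k + 1) * coordElt N ν *
          (shift I N ^ (2 * ν k + 1))⁻¹ * (coordElt N ν)⁻¹ := by
        simp only [f₀, map_mul, map_inv, map_pow, ρu, ρx, h, mul_one]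
      rw [h1, commutator_coordElt]
      refine ⟨rfl, ?_, wreathLength_le fun c => norm_commutator_le k c⟩
      dsimp only
      rw [mul_one, coordinates_apply hν hνN, coordinates_eq_one 1 (by simp), inv_one, mul_one]
    · have h1 : ρ (f₀ k) = shift I N ^ (2 * ν k + 1) * coordElt N ν *
          (shift I N ^ (2 * ν k + 1))⁻¹ := by
        simp only [f₀, map_mul, map_inv, map_pow, ρu, ρx, h, inv_mul_cancel_right]
      rw [h1, conj_coordElt]
      refine ⟨rfl, ?_, wreathLength_le fun c => norm_coordinates_le _⟩
      dsimp only
      rw [mul_one, coordinates_apply hν hνN]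
  let S' : Set M := (i '' S ∪ {a, b, s, x}) ∪ Set.range f₀
  have hS' : IsFiniteGeneratingSet S' :=
    ⟨hgen.1.union (Set.finite_range _), closure_eq_top_mono hgen.2 Set.subset_union_left⟩
  -- adjoin `t` conjugating `b` to `(a * b) ^ p`; the length pulled back along `ρ` vanishes on both
  obtain ⟨P, _, i', t, hP, hgenP, -, ht, hliftP, hisoP⟩ := h𝒢.exists_hnn hM hT₀ hb hc
  have hdetect := hisoP (fun y => wreathLength (ρ y)) (isLengthFunction_wreathLength.comp ρ)
    (fun w => by
      obtain ⟨n, rfl⟩ := exists_eq_of_zpow w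
      rw [map_zpow, FreeGroup.lift_apply_of, map_zpow, ρb, shift, ← map_zpow, wreathLength_inl])
    (fun w => by
      obtain ⟨n, rfl⟩ := exists_eq_of_zpow w
      rw [map_zpow, FreeGroup.lift_apply_of, map_zpow, map_pow, map_mul, ρa, ρb, one_mul, shift,
        ← map_pow, ← map_zpow, wreathLength_inl])
    S' hS'.2 (by
      rintro _ ((⟨g, -, rfl⟩ | rfl | rfl | rfl | rfl) | ⟨k, rfl⟩)
      · simp [ρi, isLengthFunction_wreathLength.map_one]
      · simp [ρa, isLengthFunction_wreathLength.map_one]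
      · simp [ρb, shift, wreathLength_inl]
      · simp [ρs, isLengthFunction_wreathLength.map_one]
      · rw [ρx]
        exact wreathLength_le fun c => norm_coordinates_le _
      · exact (ρf k).2.2)
    I f₀ (fun k => Or.inr ⟨k, rfl⟩) (fun w => by
      have : ρ (FreeGroup.lift f₀ w) = FreeGroup.lift (fun k => ρ (f₀ k)) w :=
        DFunLike.congr_fun (show ρ.comp (FreeGroup.lift f₀) = FreeGroup.lift fun k => ρ (f₀ k) from
          FreeGroup.ext_hom _ _ fun k => by simp) w
      rw [this]
      exact norm_le_wreathLength_lift (fun k => (ρf k).1) (fun k => (ρf k).2.1) w)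
  obtain ⟨r₀, hr₀, r₀a, r₀b, -⟩ := hlift G (MonoidHom.id G) 1 1 1 1 rfl (by simp) rfl
  obtain ⟨r, hr, -⟩ := hliftP G r₀ 1 (fun _ => by
    simp only [map_pow, map_mul, r₀a, r₀b, mul_one, one_pow])
  refine ⟨P, inferInstance, i'.comp i, r, _, Option I, _, swapEquiv κ, hP,
    fun g => by rw [MonoidHom.comp_apply, hr, hr₀]; rfl, hgenP S' hS', inferInstance, hdetect,
    hdetect.comp_equiv _, ?_⟩
  intro Q _ _ q₁ q₂ hq
  -- in a finite quotient, the elements `d` become trivial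
  have hf₀ : ∀ (q : P →* Q) (k : I), q (i' (f₀ k)) = q (i' (γ k)) := by
    intro q k
    have hcomm := commute_of_finite (a := q (i' a)) (b := q (i' b)) (s := q (i' s)) (t := q t)
      (x := q (i' x)) (p := 2 * N) (by simp only [← map_mul, hab])
      (by simp only [← map_mul, ← map_pow, hs]) (by simp only [← map_mul, ← map_pow, ht ⟨⟩])
      (by simp only [← map_mul, hx])
    have hu : q (i' u) = (q (i' s))⁻¹ * (q (i' a) * q (i' b)) * q (i' s) := by
      simp only [u, map_mul, map_inv]
    rw [← hu] at hcomm
    simp only [f₀, map_mul, map_pow, map_inv]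
    rw [(hcomm.pow_left _).eq, mul_inv_cancel_right, mul_inv_cancel, one_mul]
  -- the relations then kill `b` as well
  have htriv : ∀ q : P →* Q, (∀ k : κ, q (i' (γ (Sum.inl k))) = 1) → q t = 1 → ∀ y, q y = 1 := by
    intro q hγ hqt
    have h1 : q (i' a) = 1 := hγ (Sum.inr 0)
    have h2 : q (i' s) = 1 := hγ (Sum.inr 1)
    have h3 : q (i' x) = 1 := hγ (Sum.inr 2)
    have h4 : q (i' b) = 1 := by
      have h5 : q (i' (s * a)) = q (i' ((a * b) ^ (2 * N) * s)) := by rw [hs]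
      have h6 : q (t * i' b) = q (i' ((a * b) ^ (2 * N)) * t) := by rw [ht ⟨⟩]
      rw [map_mul, map_mul, h1, h2, map_mul, map_mul, h2] at h5
      rw [map_mul, map_mul, hqt] at h6
      rw [mul_one, mul_one] at h5
      rw [one_mul, mul_one, ← h5] at h6
      exact h6
    have h7 : (⊤ : Subgroup P) ≤ q.ker := by
      rw [← (hgenP _ hgen).2, Subgroup.closure_le]
      rintro _ (⟨_, ⟨g, hg, rfl⟩ | rfl | rfl | rfl | rfl, rfl⟩ | rfl)
      exacts [hγ (Sum.inl ⟨g, hg⟩), h1, h4, h2, h3, hqt]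
    exact fun y => h7 trivial
  have hone : ∀ (q : P →* Q) (k : Option κ), q (i' (f₀ (Sum.inr k))) = 1 := fun q k => by
    rw [hf₀]
    simp [γ]
  constructor
  · refine htriv q₁ (fun k => ?_) ?_
    · rw [← hf₀]
      exact (hq (some (Sum.inl k))).trans (hone q₂ _)
    · exact (hq none).trans (hone q₂ _)
  · refine htriv q₂ (fun k => ?_) ?_
    · rw [← hf₀]
      exact (hq (some (Sum.inr (some k)))).symm.trans (hone q₁ _)
    · exact (hq (some (Sum.inr none))).symm.trans (hone q₁ _)

end Factor

/-! ### The amalgam -/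

section Amalgam

variable {G : Type u} [Group G] {T : Set G} {J : Type u} {f g : J → G}

theorem wordLength_eq_of_retraction {H : Type u} [Group H] {T' : Set H}
    (hT : Subgroup.closure T = ⊤) (hT' : Subgroup.closure T' = ⊤) (i : G →* H) (r : H →* G)
    (hri : ∀ x, r (i x) = x) (hi : ∀ x ∈ T, i x ∈ T') (hr : ∀ y ∈ T', wordLength T (r y) ≤ 1)
    (x : G) : wordLength T' (i x) = wordLength T x := by
  apply le_antisymm
  · simpa using ((isLengthFunction_wordLength hT').comp i).le_mul_wordLength hT (N := 1)
      (fun x hx => wordLength_le_one (hi x hx)) x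
  · simpa [hri] using ((isLengthFunction_wordLength hT).comp r).le_mul_wordLength hT' hr (i x)

/-- The first factor of an amalgam of two copies of `G` along isometric free subgroups is
quasi-isometrically embedded: the amalgam maps to the HNN extension of the free product of the two
copies, in which this factor is isometric. -/
theorem exists_wordLength_le_amalgam (hT : IsFiniteGeneratingSet T) [Finite J]
    (hf : IsIsometricFamily T f) (hg : IsIsometricFamily T g)
    {S : Set ((edgeGraph (hf.injective hT.2) (hg.injective hT.2)).FundamentalGroup Set.univ)}
    (hS : IsFiniteGeneratingSet S) :
    ∃ C : ℕ, ∀ x : G, wordLength T x ≤ C * wordLength S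
      ((edgeGraph (hf.injective hT.2) (hg.injective hT.2)).toFundamentalGroup Set.univ false x) :=
  by
  let T' : Set (Monoid.Coprod G G) := Monoid.Coprod.inl '' T ∪ Monoid.Coprod.inr '' T
  have hT' : IsFiniteGeneratingSet T' := by
    refine ⟨(hT.1.image _).union (hT.1.image _), ?_⟩
    rw [Subgroup.closure_union, ← MonoidHom.map_closure, ← MonoidHom.map_closure, hT.2,
      ← MonoidHom.range_eq_map, ← MonoidHom.range_eq_map]
    exact Monoid.Coprod.range_inl_sup_range_inr
  have hone : wordLength T (1 : G) ≤ 1 := by simp [(isLengthFunction_wordLength hT.2).map_one]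
  have hinl := wordLength_eq_of_retraction hT.2 hT'.2 Monoid.Coprod.inl Monoid.Coprod.fst
    (by simp) (fun x hx => Or.inl ⟨x, hx, rfl⟩) (by
      rintro _ (⟨x, hx, rfl⟩ | ⟨x, hx, rfl⟩)
      · simpa using wordLength_le_one hx
      · simpa using hone)
  have hinr := wordLength_eq_of_retraction hT.2 hT'.2 Monoid.Coprod.inr Monoid.Coprod.snd
    (by simp) (fun x hx => Or.inr ⟨x, hx, rfl⟩) (by
      rintro _ (⟨x, hx, rfl⟩ | ⟨x, hx, rfl⟩)
      · simpa using hone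
      · simpa using wordLength_le_one hx)
  -- only the group-theoretic conclusions are needed here, so the class of all groups will do
  obtain ⟨P, _, i, t, -, hgen, hiso, ht, -, -⟩ :=
    ClosedUnderIsometricFreeAmalgamation.exists_hnn (𝒢 := fun _ _ => True)
      (by intro V E _ _ X T' _ _ _ _ Γ _ _; trivial) trivial hT'
      (hf.map Monoid.Coprod.inl hinl) (hg.map Monoid.Coprod.inr hinr)
  -- the copies of `G` agree on the free subgroup once the second one is conjugated by `t`
  let i₁ : G →* P := i.comp Monoid.Coprod.inl
  let i₂ : G →* P := (MulAut.conj t⁻¹).toMonoidHom.comp (i.comp Monoid.Coprod.inr)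
  have hi : i₁.comp (FreeGroup.lift f) = i₂.comp (FreeGroup.lift g) := by
    ext k
    simp [i₁, i₂, mul_assoc, ← ht]
  let X := edgeGraph (hf.injective hT.2) (hg.injective hT.2)
  let h : ∀ v, X.vertexGroup v →* P := fun v => match v with
    | false => i₁
    | true => i₂
  let Θ : X.FundamentalGroup Set.univ →* P := X.lift h (fun _ => 1)
    (fun _ w => by
      rw [mul_one, one_mul]
      exact DFunLike.congr_fun hi w) (by simp)
  obtain ⟨C, hC⟩ := exists_wordLength_map_le hS (hgen T' hT').2 Θ
  refine ⟨C, fun x => ?_⟩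
  have h1 : Θ (X.toFundamentalGroup Set.univ false x) = i (Monoid.Coprod.inl x) :=
    X.lift_toFundamentalGroup h _ _ _ false x
  rw [← hinl x, ← hiso, ← h1]
  exact hC _

theorem toFundamentalGroup_edgeGraph (hf : Function.Injective (FreeGroup.lift f))
    (hg : Function.Injective (FreeGroup.lift g)) (j : J) :
    (edgeGraph hf hg).toFundamentalGroup Set.univ false (f j) =
      (edgeGraph hf hg).toFundamentalGroup Set.univ true (g j) := by
  have := (edgeGraph hf hg).toFundamentalGroup_sourceMap_mul Set.univ () (FreeGroup.of j)
  rw [GraphOfGroups.stableLetter_eq_one _ _ (Set.mem_univ _), mul_one, one_mul] at this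
  have h1 : FreeGroup.lift f (FreeGroup.of j) = f j := FreeGroup.lift_apply_of
  have h2 : FreeGroup.lift g (FreeGroup.of j) = g j := FreeGroup.lift_apply_of
  rw [← h1, ← h2]
  exact this

end Amalgam

end IsometricAmalgam

theorem theoremA (𝒢 : ∀ (G : Type u) [Group G], Prop)
    (hfg : ∀ (G : Type u) [Group G], 𝒢 G → Group.FG G)
    (hclosed : IsometricAmalgam.ClosedUnderIsometricFreeAmalgamation 𝒢)
    (G : Type u) [Group G] (hG : 𝒢 G) :
    ∃ (Ghat : Type u) (_ : Group Ghat) (φ : G →* Ghat),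
      𝒢 Ghat ∧
      Function.Injective φ ∧
      (∀ (S : Set G) (S' : Set Ghat),
        IsometricAmalgam.IsFiniteGeneratingSet S → IsometricAmalgam.IsFiniteGeneratingSet S' →
          IsometricAmalgam.IsQuasiIsometricEmbedding S S' φ) ∧
      ∀ H : Subgroup Ghat, H.FiniteIndex → H = ⊤ := by
  open IsometricAmalgam in
  obtain ⟨S₀, hS₀, hS₀'⟩ := Group.fg_iff.1 (hfg G hG)
  obtain ⟨P, _, i, r, T, J, f, e, hP, hri, hT, _, hf, hfe, hfin⟩ :=
    hclosed.exists_factor hG ⟨hS₀', hS₀⟩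
  let X := edgeGraph (hf.injective hT.2) (hfe.injective hT.2)
  let i₁ : P →* X.FundamentalGroup Set.univ := X.toFundamentalGroup Set.univ false
  let i₂ : P →* X.FundamentalGroup Set.univ := X.toFundamentalGroup Set.univ true
  have hX : 𝒢 (X.FundamentalGroup Set.univ) := hclosed.amalgam hP hT hf hfe
  refine ⟨X.FundamentalGroup Set.univ, inferInstance, i₁.comp i, hX, ?_, ?_, ?_⟩
  · obtain ⟨S', hS', hS''⟩ := Group.fg_iff.1 (hfg _ hX)
    obtain ⟨C, hC⟩ := exists_wordLength_le_amalgam hT hf hfe ⟨hS'', hS'⟩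
    rw [injective_iff_map_eq_one]
    intro g hg
    have h1 : wordLength T (i g) ≤ C * wordLength S' (i₁ (i g)) := hC (i g)
    rw [show i₁ (i g) = 1 from hg, (isLengthFunction_wordLength hS').map_one, mul_zero] at h1
    rw [← hri g, eq_one_of_wordLength_eq_zero hT.2 (Nat.le_zero.1 h1), map_one]
  · intro S S' hS hS'
    obtain ⟨C₁, h₁⟩ := exists_wordLength_map_le hS hS'.2 (i₁.comp i)
    obtain ⟨C₂, h₂⟩ := exists_wordLength_map_le hT hS.2 r
    obtain ⟨C₃, h₃⟩ := exists_wordLength_le_amalgam hT hf hfe hS'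
    have h₄ : ∀ g, wordLength S g ≤ C₂ * C₃ * wordLength S' (i₁.comp i g) := fun g => by
      have := h₂ (i g)
      rw [hri] at this
      rw [mul_assoc]
      exact this.trans (Nat.mul_le_mul_left _ (h₃ (i g)))
    refine ⟨1 + C₁ + C₂ * C₃, 0, ?_, le_rfl, fun x y => ?_⟩
    · have : (0 : ℝ) ≤ C₁ + C₂ * C₃ := by positivity
      linarith
    · have h5 : (wordDist S x y : ℝ) ≤ C₂ * C₃ * wordDist S' (i₁.comp i x) (i₁.comp i y) := by
        have := h₄ (x⁻¹ * y)
        rw [map_mul, map_inv] at this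
        exact_mod_cast this
      have h6 : (wordDist S' (i₁.comp i x) (i₁.comp i y) : ℝ) ≤ C₁ * wordDist S x y := by
        have := h₁ (x⁻¹ * y)
        rw [map_mul, map_inv] at this
        exact_mod_cast this
      have hK : (0 : ℝ) < 1 + C₁ + C₂ * C₃ := by positivity
      have h7 : (0 : ℝ) ≤ (1 + C₁) * wordDist S' (i₁.comp i x) (i₁.comp i y) := by positivity
      have h8 : (0 : ℝ) ≤ (1 + C₂ * C₃) * wordDist S x y := by positivity
      constructor
      · rw [sub_zero, one_div, inv_mul_le_iff₀ hK]
        linarith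
      · linarith
  · intro H hH
    let q := QuotientGroup.mk' H.normalCore
    have : Finite (X.FundamentalGroup Set.univ ⧸ H.normalCore) := inferInstance
    obtain ⟨h1, h2⟩ := hfin _ (q.comp i₁) (q.comp i₂) fun j =>
      congrArg q (toFundamentalGroup_edgeGraph (hf.injective hT.2) (hfe.injective hT.2) j)
    have hq : q = 1 := X.hom_ext
      (fun v y => match v with
        | false => h1 y
        | true => h2 y)
      (fun e => by rw [X.stableLetter_eq_one Set.univ (Set.mem_univ e), map_one, map_one])
    rw [eq_top_iff]
    intro y _
    refine H.normalCore_le ((QuotientGroup.eq_one_iff y).1 ?_)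
    exact DFunLike.congr_fun hq y
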